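/- For $0<\varepsilon<\tfrac12$ let $\Gamma=\Gamma_\varepsilon$ be the compact metric tree obtained as follows. Take two intervals of length $1$, and two 3-stars (each with three edges of length $\tfrac12-\varepsilon$ meeting at a central vertex), and glue together one endpoint of each interval and one leaf of each star at a single vertex $v_0$. Let $v_l,v_r$ be the free endpoints of the two intervals, let $v_{u_1},v_{u_2}$ be the two remaining leaves of the first star and $v_{d_1},v_{d_2}$ those of the second star. Write $\mathcal P^2\subset\Gamma$ for the path formed by the two intervals, and $\mathcal S^2\subset\Gamma$ for the tree formed by the two stars. On a compact metric graph let $-\Delta$ be the Laplacian with standard vertex conditions: its domain consists of the functions that are $H^2$ on every edge, continuous at the vertices, and whose outgoing derivatives sum to zero at every vertex, and $-\Delta f=-f''$ on each edge. Let $\mu_1\le\mu_2\le\dots$ be its eigenvalues counted with multiplicity. (1) For every $0<\varepsilon<\tfrac12$, $\Gamma$ is a tree with $\operatorname{diam}(\Gamma)=2$ in the path metric, and the only pair of points of $\Gamma$ at distance $\operatorname{diam}(\Gamma)$ is $\{v_l,v_r\}$. (2) There is $\varepsilon_0>0$ such that for all $0<\varepsilon<\varepsilon_0$ one has $\varepsilon<\tfrac12$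 and: $\mu_2(\Gamma)$ is the smallest positive eigenvalue of $-\Delta_\Gamma$, it is simple, and $\mu_2(\Gamma)=\mu_2(\mathcal S^2)$. Every eigenfunction $f$ for $\mu_2(\Gamma)$ (that is, $f\neq0$ with $-\Delta_\Gamma f=\mu_2(\Gamma)f$) vanishes identically on $\mathcal P^2$ and, after possibly replacing $f$ by $-f$, the set of points where $f$ attains its global maximum is exactly $\{v_{u_1},v_{u_2}\}$ and the set where it attains its global minimum is exactly $\{v_{d_1},v_{d_2}\}$. In particular, any two points at which $f$ attains a global extremum have distance strictly less than $\operatorname{diam}(\Gamma)$. -/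

import Mathlib

open Set MeasureTheory
open scoped ENNReal NNReal

/-- A finite compact metric graph: every edge `e` runs from `src e` to `tgt e` and is identified
with the interval `[0, len e]`; the orientation is only a choice of parametrisation.
Every vertex is an endpoint of some edge. -/
structure MetricGraph (V E : Type) where
  src : E → V
  tgt : E → V
  len : E → ℝ
  len_pos : ∀ e, 0 < len e
  exists_edge : ∀ v, ∃ e, src e = v ∨ tgt e = v

namespace MetricGraph

variable {V E : Type}

/-- The points of the metric graph: its vertices and the points inside its edges. -/
inductive Point (Γ : MetricGraph V E) : Type
  | vertex (v : V) : Point Γ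
  | inner (e : E) (t : ℝ) (ht : t ∈ Ioo 0 (Γ.len e)) : Point Γ

/-- The combinatorial graph underlying the metric graph, with loops and multiplicities dropped. -/
def toSimpleGraph (Γ : MetricGraph V E) : SimpleGraph V :=
  SimpleGraph.fromRel fun v w => ∃ e, Γ.src e = v ∧ Γ.tgt e = w

/-- The metric graph is a tree: no loops, no parallel edges, and the underlying simple graph is
connected and has no cycles. -/
def IsTree (Γ : MetricGraph V E) : Prop :=
  (∀ e, Γ.src e ≠ Γ.tgt e) ∧
  (∀ e e', s(Γ.src e, Γ.tgt e) = s(Γ.src e', Γ.tgt e') → e = e') ∧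
  Γ.toSimpleGraph.IsTree

open Classical in
/-- The parametrisation of the edge `e` by `t ∈ [0, len e]`
(constant, equal to the endpoint, outside this interval). -/
noncomputable def edgePt (Γ : MetricGraph V E) (e : E) (t : ℝ) : Γ.Point :=
  if h0 : t ≤ 0 then .vertex (Γ.src e)
  else if h1 : Γ.len e ≤ t then .vertex (Γ.tgt e)
  else .inner e t ⟨not_le.mp h0, not_le.mp h1⟩

/-! ### The path metric -/

/-- `Γ.PathLength p q r`: the points `p` and `q` are joined by a finite concatenation of segments,
each contained in one edge, of total length `r`. -/
inductive PathLength (Γ : MetricGraph V E) (p : Γ.Point) : Γ.Point → ℝ≥0 → Prop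
  | refl : PathLength Γ p p 0
  | step (e : E) (s t : ℝ) (r : ℝ≥0) (hs : s ∈ Icc 0 (Γ.len e)) (ht : t ∈ Icc 0 (Γ.len e))
      (h : PathLength Γ p (Γ.edgePt e s) r) :
      PathLength Γ p (Γ.edgePt e t) (r + nndist s t)

theorem PathLength.trans {Γ : MetricGraph V E} {p q x : Γ.Point} {a b : ℝ≥0}
    (h : Γ.PathLength p q a) (h' : Γ.PathLength q x b) : Γ.PathLength p x (a + b) := by
  induction h' with
  | refl => simpa using h
  | step e s t r hs ht _ ih => rw [← add_assoc]; exact .step e s t _ hs ht ih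

theorem PathLength.symm {Γ : MetricGraph V E} {p q : Γ.Point} {a : ℝ≥0}
    (h : Γ.PathLength p q a) : Γ.PathLength q p a := by
  induction h with
  | refl => exact .refl
  | step e s t r hs ht _ ih =>
    have h1 : Γ.PathLength (Γ.edgePt e t) (Γ.edgePt e s) (0 + nndist t s) :=
      .step e t s 0 ht hs .refl
    have h2 := h1.trans ih
    rwa [zero_add, add_comm, nndist_comm] at h2

/-- The path metric: the distance of two points is the infimum of the lengths of the paths that
join them (and `∞` if there are none). -/
noncomputable instance (Γ : MetricGraph V E) : PseudoEMetricSpace Γ.Point where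
  edist p q := ⨅ (r : ℝ≥0) (_ : Γ.PathLength p q r), (r : ℝ≥0∞)
  edist_self p := le_antisymm (iInf₂_le_of_le 0 .refl (by simp)) bot_le
  edist_comm p q := by
    refine le_antisymm ?_ ?_ <;>
      exact le_iInf₂ fun r hr => iInf₂_le_of_le r hr.symm le_rfl
  edist_triangle p q x := by
    simp only [ENNReal.iInf_add, ENNReal.add_iInf]
    refine le_iInf₂ fun b hb => le_iInf₂ fun a ha => ?_
    exact iInf₂_le_of_le (a + b) (ha.trans hb) (by push_cast; exact le_rfl)

/-! ### The Laplacian with standard vertex conditions -/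

/-- The derivative of `f` along the edge `e` at the parameter `t ∈ [0, len e]`
(one-sided at the endpoints). -/
noncomputable def edgeDeriv (Γ : MetricGraph V E) (f : Γ.Point → ℝ) (e : E) (t : ℝ) : ℝ :=
  derivWithin (fun s => f (Γ.edgePt e s)) (Icc 0 (Γ.len e)) t

theorem edgeDeriv_add (Γ : MetricGraph V E) {f f' : Γ.Point → ℝ} {e : E} {t : ℝ} (ht : t ∈ Icc 0 (Γ.len e))
    (hf : DifferentiableOn ℝ (fun s => f (Γ.edgePt e s)) (Icc 0 (Γ.len e)))
    (hf' : DifferentiableOn ℝ (fun s => f' (Γ.edgePt e s)) (Icc 0 (Γ.len e))) :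
    Γ.edgeDeriv (f + f') e t = Γ.edgeDeriv f e t + Γ.edgeDeriv f' e t :=
  derivWithin_add (hf t ht) (hf' t ht)

theorem edgeDeriv_smul (Γ : MetricGraph V E) (c : ℝ) (f : Γ.Point → ℝ) (e : E) (t : ℝ) :
    Γ.edgeDeriv (c • f) e t = c * Γ.edgeDeriv f e t :=
  derivWithin_const_mul_field c

/-- `Γ.IsLaplacian f g`: the function `f` belongs to the domain of the standard Laplacian
and `Δ f = g` in `L²`.  That is, on every edge `f` lies in `H²`, with second derivative `g`
(`f` is differentiable, and `f'` is an integral of the square integrable function `g`); `f` is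
continuous at the vertices, as it is a function on `Γ.Point` that is continuous along each closed
edge; and at each vertex the outgoing derivatives add up to zero. -/
structure IsLaplacian [Fintype E] [DecidableEq V] (Γ : MetricGraph V E)
    (f : Γ.Point → ℝ) (g : E → ℝ → ℝ) : Prop where
  differentiableOn : ∀ e, DifferentiableOn ℝ (fun s => f (Γ.edgePt e s)) (Icc 0 (Γ.len e))
  memLp : ∀ e, MemLp (g e) 2 (volume.restrict (Icc 0 (Γ.len e)))
  edgeDeriv_eq : ∀ e, ∀ t ∈ Icc 0 (Γ.len e),
    Γ.edgeDeriv f e t = Γ.edgeDeriv f e 0 + ∫ s in (0 : ℝ)..t, g e s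
  kirchhoff : ∀ v, (∑ e with Γ.src e = v, Γ.edgeDeriv f e 0)
    - (∑ e with Γ.tgt e = v, Γ.edgeDeriv f e (Γ.len e)) = 0

section Eigen

variable [Fintype E] [DecidableEq V] (Γ : MetricGraph V E)

theorem IsLaplacian.intervalIntegrable {Γ : MetricGraph V E} {f : Γ.Point → ℝ} {g : E → ℝ → ℝ}
    (h : Γ.IsLaplacian f g) (e : E) {t : ℝ} (ht : t ∈ Icc 0 (Γ.len e)) :
    IntervalIntegrable (g e) volume 0 t := by
  have h1 : IntegrableOn (g e) (Icc 0 (Γ.len e)) :=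
    (h.memLp e).integrable (by norm_num)
  rw [intervalIntegrable_iff_integrableOn_Ioc_of_le ht.1]
  exact h1.mono_set fun x hx => ⟨hx.1.le, hx.2.trans ht.2⟩

theorem IsLaplacian.add {Γ : MetricGraph V E} {f f' : Γ.Point → ℝ} {g g' : E → ℝ → ℝ}
    (h : Γ.IsLaplacian f g) (h' : Γ.IsLaplacian f' g') :
    Γ.IsLaplacian (f + f') (g + g') where
  differentiableOn e := (h.differentiableOn e).add (h'.differentiableOn e)
  memLp e := (h.memLp e).add (h'.memLp e)
  edgeDeriv_eq e t ht := by
    have h0 : (0 : ℝ) ∈ Icc 0 (Γ.len e) := ⟨le_rfl, (Γ.len_pos e).le⟩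
    rw [Γ.edgeDeriv_add ht (h.differentiableOn e) (h'.differentiableOn e),
      Γ.edgeDeriv_add h0 (h.differentiableOn e) (h'.differentiableOn e),
      h.edgeDeriv_eq e t ht, h'.edgeDeriv_eq e t ht]
    have := intervalIntegral.integral_add (h.intervalIntegrable e ht) (h'.intervalIntegrable e ht)
    simp only [Pi.add_apply]
    rw [this]; ring
  kirchhoff v := by
    have h0 (e : E) : Γ.edgeDeriv (f + f') e 0 = Γ.edgeDeriv f e 0 + Γ.edgeDeriv f' e 0 :=
      Γ.edgeDeriv_add ⟨le_rfl, (Γ.len_pos e).le⟩ (h.differentiableOn e) (h'.differentiableOn e)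
    have h1 (e : E) : Γ.edgeDeriv (f + f') e (Γ.len e)
        = Γ.edgeDeriv f e (Γ.len e) + Γ.edgeDeriv f' e (Γ.len e) :=
      Γ.edgeDeriv_add ⟨(Γ.len_pos e).le, le_rfl⟩ (h.differentiableOn e) (h'.differentiableOn e)
    simp only [h0, h1, Finset.sum_add_distrib]
    linarith [h.kirchhoff v, h'.kirchhoff v]

theorem IsLaplacian.smul {Γ : MetricGraph V E} {f : Γ.Point → ℝ} {g : E → ℝ → ℝ} (c : ℝ)
    (h : Γ.IsLaplacian f g) : Γ.IsLaplacian (c • f) (c • g) where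
  differentiableOn e := (h.differentiableOn e).const_mul c
  memLp e := (h.memLp e).const_mul c
  edgeDeriv_eq e t ht := by
    simp only [edgeDeriv_smul, h.edgeDeriv_eq e t ht, Pi.smul_apply, smul_eq_mul,
      intervalIntegral.integral_const_mul]
    ring
  kirchhoff v := by
    simp only [edgeDeriv_smul, ← Finset.mul_sum, ← mul_sub, h.kirchhoff v, mul_zero]

theorem isLaplacian_zero : Γ.IsLaplacian 0 0 where
  differentiableOn _ := differentiableOn_const _
  memLp _ := MemLp.zero
  edgeDeriv_eq e t ht := by simp [edgeDeriv]
  kirchhoff v := by simp [edgeDeriv]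

/-- The space `ker (-Δ - μ)`. -/
noncomputable def eigenspace (μ : ℝ) : Submodule ℝ (Γ.Point → ℝ) where
  carrier := {f | Γ.IsLaplacian f fun e t => -(μ * f (Γ.edgePt e t))}
  add_mem' {f f'} h h' := by
    have := IsLaplacian.add h h'
    refine Eq.mp (congrArg (Γ.IsLaplacian _) ?_) this
    funext e t; simp only [Pi.add_apply]; ring
  zero_mem' := by
    have := Γ.isLaplacian_zero
    refine Eq.mp (congrArg (Γ.IsLaplacian _) ?_) this
    funext e t; simp
  smul_mem' c f h := by
    have := IsLaplacian.smul c h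
    refine Eq.mp (congrArg (Γ.IsLaplacian _) ?_) this
    funext e t; simp only [Pi.smul_apply, smul_eq_mul]; ring

/-- The `k`-th eigenvalue (`k ≥ 1`) of `-Δ`, in increasing order and counted with multiplicity:
the least `μ` such that the eigenvalues `ν ≤ μ` have total multiplicity at least `k`. -/
noncomputable def eigenvalue (k : ℕ) : ℝ :=
  sInf {μ : ℝ | (k : Cardinal) ≤ Module.rank ℝ ↥(⨆ (ν : ℝ) (_ : ν ≤ μ), Γ.eigenspace ν)}

end Eigen

end MetricGraph

namespace HotSpots

/-! ### The two stars glued together -/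

/-- Vertices of the union of two 3-stars: the common vertex `v0`, the centres `cu`, `cd` of the
upper and lower star, and the leaves `u1`, `u2`, `d1`, `d2`. -/
inductive StarVertex : Type
  | v0 | cu | cd | u1 | u2 | d1 | d2
  deriving DecidableEq

/-- Edges of the union of two 3-stars. -/
inductive StarEdge : Type
  | su | sd | u1 | u2 | d1 | d2
  deriving DecidableEq

instance : Fintype StarEdge where
  elems := {.su, .sd, .u1, .u2, .d1, .d2}
  complete x := by cases x <;> decide

/-- Two copies of the 3-star with edges of length `1/2 - ε`, glued at the leaf `v0`. -/
noncomputable def starSquare (ε : ℝ) (hε : ε < 1 / 2) : MetricGraph StarVertex StarEdge where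
  src
    | .su | .sd => .v0
    | .u1 | .u2 => .cu
    | .d1 | .d2 => .cd
  tgt
    | .su => .cu
    | .sd => .cd
    | .u1 => .u1
    | .u2 => .u2
    | .d1 => .d1
    | .d2 => .d2
  len _ := 1 / 2 - ε
  len_pos _ := by linarith
  exists_edge
    | .v0 => ⟨.su, .inl rfl⟩
    | .cu => ⟨.su, .inr rfl⟩
    | .cd => ⟨.sd, .inr rfl⟩
    | .u1 => ⟨.u1, .inr rfl⟩
    | .u2 => ⟨.u2, .inr rfl⟩
    | .d1 => ⟨.d1, .inr rfl⟩
    | .d2 => ⟨.d2, .inr rfl⟩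

/-! ### The whole tree -/

/-- Vertices of the tree: those of the two stars and the endpoints `vl`, `vr` of the path. -/
inductive TreeVertex : Type
  | v0 | vl | vr | cu | cd | u1 | u2 | d1 | d2
  deriving DecidableEq

/-- Edges of the tree: those of the two stars and the two intervals `l`, `r`. -/
inductive TreeEdge : Type
  | l | r | su | sd | u1 | u2 | d1 | d2
  deriving DecidableEq

instance : Fintype TreeEdge where
  elems := {.l, .r, .su, .sd, .u1, .u2, .d1, .d2}
  complete x := by cases x <;> decide

/-- Two intervals of length `1` and two 3-stars with edges of length `1/2 - ε`, where one endpoint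
of each interval and one leaf of each star are glued together at the central vertex `v0`. -/
noncomputable def tree (ε : ℝ) (hε : ε < 1 / 2) : MetricGraph TreeVertex TreeEdge where
  src
    | .l | .r | .su | .sd => .v0
    | .u1 | .u2 => .cu
    | .d1 | .d2 => .cd
  tgt
    | .l => .vl
    | .r => .vr
    | .su => .cu
    | .sd => .cd
    | .u1 => .u1
    | .u2 => .u2
    | .d1 => .d1
    | .d2 => .d2
  len
    | .l | .r => 1
    | _ => 1 / 2 - ε
  len_pos e := by cases e <;> simp only <;> linarith
  exists_edge
    | .v0 => ⟨.l, .inl rfl⟩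
    | .vl => ⟨.l, .inr rfl⟩
    | .vr => ⟨.r, .inr rfl⟩
    | .cu => ⟨.su, .inr rfl⟩
    | .cd => ⟨.sd, .inr rfl⟩
    | .u1 => ⟨.u1, .inr rfl⟩
    | .u2 => ⟨.u2, .inr rfl⟩
    | .d1 => ⟨.d1, .inr rfl⟩
    | .d2 => ⟨.d2, .inr rfl⟩

/-- The path part of the tree, formed by the two intervals. -/
noncomputable def pathPart (ε : ℝ) (hε : ε < 1 / 2) : Set (tree ε hε).Point :=
  (tree ε hε).edgePt .l '' Icc 0 1 ∪ (tree ε hε).edgePt .r '' Icc 0 1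

/-- The set of points where `f` attains its global maximum. -/
def argmax {X : Type} (f : X → ℝ) : Set X := {p | ∀ q, f q ≤ f p}

/-- The set of points where `f` attains its global minimum. -/
def argmin {X : Type} (f : X → ℝ) : Set X := {p | ∀ q, f p ≤ f q}

end HotSpots

/-!
Write `a = 1 / 2 - ε` for the edge length of the stars.

*Geometry.* Every point of the tree lies within distance `1` of the central vertex `v0`, and only
the two ends of the path are at distance exactly `1` (`HotSpots.edist_v0`), because the leaves of
the stars are at distance `2 a < 1`. Hence the diameter is at most `2`, and by the triangle
inequality through `v0` only the pair of ends of the path can realise it. That they do is seen from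
the signed coordinate along the path, which is a `1`-Lipschitz function
(`MetricGraph.lipschitzWith_one`).

*Spectrum.* An eigenfunction solves `f'' = -μ f` on each edge. Multiplying by `f` and summing over
the edges, the Kirchhoff conditions make the energy `∑ ∫ f'² - μ f²` vanish
(`MetricGraph.energy_eq_zero`); so there are no negative eigenvalues, the kernel consists of the
constants, and the second eigenvalue of a connected graph is its smallest positive one
(`MetricGraph.eigenvalue_two`).

For `μ = k²` an eigenfunction is trigonometric on each edge. With `x = f v0`, `s = sin (k a)`,
`c = cos (k a)`, and with `k q` the outgoing derivative at `v0` into a star, the conditions at the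
centre and the leaves of that star give `q (1 - 3 s²) = 3 s c x` (`MetricGraph.IsStar.relation`).
The corresponding relation for an interval of length `1` is `q cos k = x sin k`. Let `θ` be the
angle with `3 sin² θ = 1`. If `k a < θ` and `k < π / 2`, every outgoing derivative at `v0` is a
positive multiple of `x`; as they add up to zero, `x = 0`, and then `f = 0`. If `k a = θ`, the star
relation reads `x = 0`, and `f` is an eigenfunction of the stars that vanishes at `v0`. As
`θ < π / 4`, for small `ε` one has `θ / a < π / 2`, so `cos k ≠ 0` and `f` vanishes on the path; the Kirchhoff
condition at `v0` then makes it antisymmetric under the exchange of the two stars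
(`HotSpots.tree_eigenspace_freq`). So `(θ / a)²` is the second eigenvalue, it is simple, and the
explicit eigenfunction has its extrema at the leaves of the stars (`HotSpots.treeFun_bounds`).
-/

namespace MetricGraph

/-! ### Points, distances and the underlying graph -/

section Points

variable {V E : Type} (Γ : MetricGraph V E)

theorem edgePt_of_nonpos (e : E) {t : ℝ} (ht : t ≤ 0) : Γ.edgePt e t = .vertex (Γ.src e) :=
  dif_pos ht

theorem edgePt_zero (e : E) : Γ.edgePt e 0 = .vertex (Γ.src e) :=
  Γ.edgePt_of_nonpos e le_rfl

theorem edgePt_of_len_le (e : E) {t : ℝ} (ht : Γ.len e ≤ t) :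
    Γ.edgePt e t = .vertex (Γ.tgt e) := by
  rw [edgePt, dif_neg (not_le.mpr ((Γ.len_pos e).trans_le ht)), dif_pos ht]

theorem edgePt_len (e : E) : Γ.edgePt e (Γ.len e) = .vertex (Γ.tgt e) :=
  Γ.edgePt_of_len_le e le_rfl

theorem edgePt_of_mem_Ioo (e : E) {t : ℝ} (ht : t ∈ Ioo 0 (Γ.len e)) :
    Γ.edgePt e t = .inner e t ht := by
  rw [edgePt, dif_neg (not_le.mpr ht.1), dif_neg (not_le.mpr ht.2)]

theorem zero_mem (e : E) : (0 : ℝ) ∈ Icc 0 (Γ.len e) := ⟨le_rfl, (Γ.len_pos e).le⟩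

theorem len_mem (e : E) : Γ.len e ∈ Icc 0 (Γ.len e) := ⟨(Γ.len_pos e).le, le_rfl⟩

theorem exists_edgePt_eq (p : Γ.Point) : ∃ e, ∃ t ∈ Icc 0 (Γ.len e), Γ.edgePt e t = p := by
  cases p with
  | vertex v =>
    obtain ⟨e, rfl | rfl⟩ := Γ.exists_edge v
    · exact ⟨e, 0, Γ.zero_mem e, Γ.edgePt_zero e⟩
    · exact ⟨e, Γ.len e, Γ.len_mem e, Γ.edgePt_len e⟩
  | inner e t ht => exact ⟨e, t, Ioo_subset_Icc_self ht, Γ.edgePt_of_mem_Ioo e ht⟩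

/-- Properties of points may be checked along the closed edges. -/
theorem forall_point {P : Γ.Point → Prop}
    (h : ∀ e, ∀ t ∈ Icc 0 (Γ.len e), P (Γ.edgePt e t)) (p : Γ.Point) : P p := by
  obtain ⟨e, t, ht, rfl⟩ := Γ.exists_edgePt_eq p
  exact h e t ht

/-- The function on the metric graph with value `val v` at the vertex `v` and `φ e t` at the
interior point with parameter `t` of the edge `e`. -/
def ofEdges (val : V → ℝ) (φ : E → ℝ → ℝ) : Γ.Point → ℝ
  | .vertex v => val v
  | .inner e t _ => φ e t

variable {Γ} in
theorem ofEdges_edgePt {val : V → ℝ} {φ : E → ℝ → ℝ} (h0 : ∀ e, φ e 0 = val (Γ.src e))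
    (h1 : ∀ e, φ e (Γ.len e) = val (Γ.tgt e)) (e : E) {t : ℝ} (ht : t ∈ Icc 0 (Γ.len e)) :
    Γ.ofEdges val φ (Γ.edgePt e t) = φ e t := by
  rcases ht.1.eq_or_lt with rfl | h
  · rw [edgePt_zero, h0]; rfl
  rcases ht.2.eq_or_lt with rfl | h'
  · rw [edgePt_len, h1]; rfl
  · rw [Γ.edgePt_of_mem_Ioo e ⟨h, h'⟩]; rfl

theorem edist_edgePt_le (e : E) {s t : ℝ} (hs : s ∈ Icc 0 (Γ.len e)) (ht : t ∈ Icc 0 (Γ.len e)) :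
    edist (Γ.edgePt e s) (Γ.edgePt e t) ≤ ENNReal.ofReal |s - t| := by
  have h : Γ.PathLength (Γ.edgePt e s) (Γ.edgePt e t) (0 + nndist s t) := .step e s t 0 hs ht .refl
  refine iInf₂_le_of_le _ h ?_
  rw [zero_add, ← edist_nndist, edist_dist, Real.dist_eq]

/-- A function that is `1`-Lipschitz along every edge is `1`-Lipschitz for the path metric;
such functions bound distances from below. -/
theorem lipschitzWith_one {h : Γ.Point → ℝ}
    (hh : ∀ e, ∀ s ∈ Icc 0 (Γ.len e), ∀ t ∈ Icc 0 (Γ.len e),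
      |h (Γ.edgePt e s) - h (Γ.edgePt e t)| ≤ |s - t|) : LipschitzWith 1 h := by
  intro p q
  rw [ENNReal.coe_one, one_mul]
  refine le_iInf₂ fun r hr => ?_
  induction hr with
  | refl => simp
  | step e s t r hs ht _ ih =>
    refine (edist_triangle _ (h (Γ.edgePt e s)) _).trans ?_
    push_cast
    refine add_le_add ih ?_
    rw [edist_dist, edist_dist, Real.dist_eq, Real.dist_eq]
    exact ENNReal.ofReal_le_ofReal (hh e s hs t ht)

theorem adj_of_edge {e : E} (he : Γ.src e ≠ Γ.tgt e) :
    Γ.toSimpleGraph.Adj (Γ.src e) (Γ.tgt e) := by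
  rw [toSimpleGraph, SimpleGraph.fromRel_adj]
  exact ⟨he, .inl ⟨e, rfl, rfl⟩⟩

/-- A connected metric graph without loops and parallel edges is a tree if it has one vertex more
than it has edges. -/
theorem isTree_of_card [Finite V] (h1 : ∀ e, Γ.src e ≠ Γ.tgt e)
    (h2 : ∀ e e', s(Γ.src e, Γ.tgt e) = s(Γ.src e', Γ.tgt e') → e = e')
    (h3 : Γ.toSimpleGraph.Connected) (h4 : Nat.card E + 1 = Nat.card V) : Γ.IsTree := by
  refine ⟨h1, h2, ?_⟩
  rw [SimpleGraph.isTree_iff_connected_and_card]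
  refine ⟨h3, ?_⟩
  have : Γ.toSimpleGraph.edgeSet = Set.range fun e => s(Γ.src e, Γ.tgt e) := by
    ext x
    induction x with
    | h v w =>
      rw [SimpleGraph.mem_edgeSet, toSimpleGraph, SimpleGraph.fromRel_adj]
      constructor
      · rintro ⟨-, ⟨e, rfl, rfl⟩ | ⟨e, rfl, rfl⟩⟩
        · exact ⟨e, rfl⟩
        · exact ⟨e, Sym2.eq_swap⟩
      · rintro ⟨e, he⟩
        rcases Sym2.eq_iff.mp he with ⟨rfl, rfl⟩ | ⟨rfl, rfl⟩
        · exact ⟨h1 e, .inl ⟨e, rfl, rfl⟩⟩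
        · exact ⟨(h1 e).symm, .inr ⟨e, rfl, rfl⟩⟩
  rw [this, Nat.card_range_of_injective fun e e' => h2 e e', h4]

end Points

/-! ### Eigenfunctions as solutions of an ODE on every edge -/

section Eigenfunctions

variable {V E : Type} [Fintype E] [DecidableEq V] {Γ : MetricGraph V E} {f : Γ.Point → ℝ} {μ : ℝ}

theorem mem_eigenspace :
    f ∈ Γ.eigenspace μ ↔ Γ.IsLaplacian f fun e t => -(μ * f (Γ.edgePt e t)) := Iff.rfl

theorem hasDerivWithinAt_edge (h : f ∈ Γ.eigenspace μ) (e : E) {t : ℝ}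
    (ht : t ∈ Icc 0 (Γ.len e)) :
    HasDerivWithinAt (fun s => f (Γ.edgePt e s)) (Γ.edgeDeriv f e t) (Icc 0 (Γ.len e)) t :=
  (mem_eigenspace.mp h).differentiableOn e t ht |>.hasDerivWithinAt

theorem continuous_edge (h : f ∈ Γ.eigenspace μ) (e : E) :
    Continuous fun s => f (Γ.edgePt e s) := by
  have hc : ContinuousOn (fun s => f (Γ.edgePt e s)) (Icc 0 (Γ.len e)) :=
    ((mem_eigenspace.mp h).differentiableOn e).continuousOn
  have := (continuousOn_iff_continuous_domRestrict.mp hc).Icc_extend' (h := (Γ.len_pos e).le)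
  convert this using 2 with s
  rcases le_total s 0 with hs | hs
  · rw [IccExtend_of_le_left _ _ hs, edgePt_of_nonpos _ _ hs]
    simp [edgePt_zero]
  rcases le_total (Γ.len e) s with hs' | hs'
  · rw [IccExtend_of_right_le _ _ hs', edgePt_of_len_le _ _ hs']
    simp [edgePt_len]
  · rw [IccExtend_of_mem _ _ ⟨hs, hs'⟩]; rfl

theorem hasDerivWithinAt_edgeDeriv (h : f ∈ Γ.eigenspace μ) (e : E) {t : ℝ}
    (ht : t ∈ Icc 0 (Γ.len e)) :
    HasDerivWithinAt (Γ.edgeDeriv f e) (-(μ * f (Γ.edgePt e t))) (Icc 0 (Γ.len e)) t := by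
  have hc : Continuous fun s => -(μ * f (Γ.edgePt e s)) :=
    ((continuous_edge h e).const_mul μ).neg
  have h1 := ((hc.integral_hasStrictDerivAt 0 t).hasDerivAt.const_add
    (Γ.edgeDeriv f e 0)).hasDerivWithinAt (s := Icc 0 (Γ.len e))
  exact h1.congr_of_mem (fun s hs => (mem_eigenspace.mp h).edgeDeriv_eq e s hs) ht

/-- A function given along each edge by a `C²` solution of `φ'' = -μ φ` that satisfies the
Kirchhoff conditions is an eigenfunction. -/
theorem ofEdges_mem_eigenspace {val : V → ℝ} {φ ψ : E → ℝ → ℝ}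
    (h0 : ∀ e, φ e 0 = val (Γ.src e)) (h1 : ∀ e, φ e (Γ.len e) = val (Γ.tgt e))
    (hφ : ∀ e t, HasDerivAt (φ e) (ψ e t) t) (hψ : ∀ e t, HasDerivAt (ψ e) (-(μ * φ e t)) t)
    (hK : ∀ v, (∑ e with Γ.src e = v, ψ e 0) - (∑ e with Γ.tgt e = v, ψ e (Γ.len e)) = 0) :
    Γ.ofEdges val φ ∈ Γ.eigenspace μ := by
  have hd : ∀ e, ∀ t ∈ Icc 0 (Γ.len e),
      HasDerivWithinAt (fun s => Γ.ofEdges val φ (Γ.edgePt e s)) (ψ e t) (Icc 0 (Γ.len e)) t :=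
    fun e t ht => (hφ e t).hasDerivWithinAt.congr_of_mem
      (fun s hs => ofEdges_edgePt h0 h1 e hs) ht
  have hd' : ∀ e, ∀ t ∈ Icc 0 (Γ.len e), Γ.edgeDeriv (Γ.ofEdges val φ) e t = ψ e t :=
    fun e t ht => (hd e t ht).derivWithin (uniqueDiffOn_Icc (Γ.len_pos e) t ht)
  have hc : ∀ e, Continuous (φ e) := fun e =>
    continuous_iff_continuousAt.mpr fun t => (hφ e t).continuousAt
  have hc' : ∀ e, Continuous fun t => -(μ * φ e t) := fun e => ((hc e).const_mul μ).neg
  rw [mem_eigenspace]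
  refine ⟨fun e t ht => (hd e t ht).differentiableWithinAt, fun e => ?_, fun e t ht => ?_,
    fun v => ?_⟩
  · have hco : ContinuousOn (fun t => -(μ * φ e t)) (Icc 0 (Γ.len e)) := (hc' e).continuousOn
    obtain ⟨C, hC⟩ := isCompact_Icc.exists_bound_of_continuousOn hco
    have hm : MemLp (fun t => -(μ * φ e t)) 2 (volume.restrict (Icc 0 (Γ.len e))) :=
      MemLp.of_bound (hc' e).aestronglyMeasurable C
        ((ae_restrict_iff' measurableSet_Icc).mpr (.of_forall hC))
    refine hm.ae_eq ((ae_restrict_iff' measurableSet_Icc).mpr (.of_forall fun t ht => ?_))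
    simp only [ofEdges_edgePt h0 h1 e ht]
  · rw [hd' e t ht, hd' e 0 (Γ.zero_mem e)]
    have : ∫ s in (0 : ℝ)..t, -(μ * Γ.ofEdges val φ (Γ.edgePt e s))
        = ∫ s in (0 : ℝ)..t, -(μ * φ e s) := by
      refine intervalIntegral.integral_congr fun s hs => ?_
      rw [uIcc_of_le ht.1] at hs
      rw [ofEdges_edgePt h0 h1 e ⟨hs.1, hs.2.trans ht.2⟩]
    rw [this, intervalIntegral.integral_eq_sub_of_hasDerivAt (fun s _ => hψ e s)
      ((hc' e).intervalIntegrable _ _)]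
    ring
  · simp only [fun e => hd' e 0 (Γ.zero_mem e), fun e => hd' e _ (Γ.len_mem e), hK v]

/-- Integration by parts: the energy `∑ ∫ f'² - μ f²` of an eigenfunction is zero, so for `μ ≤ 0`
its integrand vanishes. -/
theorem energy_eq_zero [Fintype V] (h : f ∈ Γ.eigenspace μ) (hμ : μ ≤ 0) (e : E) {t : ℝ}
    (ht : t ∈ Icc 0 (Γ.len e)) :
    Γ.edgeDeriv f e t ^ 2 - μ * f (Γ.edgePt e t) ^ 2 = 0 := by
  set W : E → ℝ → ℝ := fun e t => f (Γ.edgePt e t) * Γ.edgeDeriv f e t with hW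
  have hd : ∀ e, ∀ t ∈ Icc 0 (Γ.len e), HasDerivWithinAt (W e)
      (Γ.edgeDeriv f e t ^ 2 - μ * f (Γ.edgePt e t) ^ 2) (Icc 0 (Γ.len e)) t := by
    intro e t ht
    refine ((hasDerivWithinAt_edge h e ht).mul (hasDerivWithinAt_edgeDeriv h e ht)).congr_deriv ?_
    ring
  have hmono : ∀ e, MonotoneOn (W e) (Icc 0 (Γ.len e)) := fun e =>
    monotoneOn_of_hasDerivWithinAt_nonneg (convex_Icc _ _)
      (fun t ht => (hd e t ht).continuousWithinAt)
      (fun t ht => (hd e t (interior_subset ht)).mono interior_subset)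
      (fun t _ => by nlinarith [sq_nonneg (Γ.edgeDeriv f e t), sq_nonneg (f (Γ.edgePt e t))])
  have hsum : ∑ e, (W e (Γ.len e) - W e 0) = 0 := by
    have h1 : ∑ e, W e (Γ.len e)
        = ∑ v, f (.vertex v) * ∑ e with Γ.tgt e = v, Γ.edgeDeriv f e (Γ.len e) := by
      rw [← Finset.sum_fiberwise Finset.univ Γ.tgt]
      refine Finset.sum_congr rfl fun v _ => ?_
      rw [Finset.mul_sum]
      refine Finset.sum_congr rfl fun e he => ?_
      rw [← (Finset.mem_filter.mp he).2, ← edgePt_len]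
    have h0 : ∑ e, W e 0 = ∑ v, f (.vertex v) * ∑ e with Γ.src e = v, Γ.edgeDeriv f e 0 := by
      rw [← Finset.sum_fiberwise Finset.univ Γ.src]
      refine Finset.sum_congr rfl fun v _ => ?_
      rw [Finset.mul_sum]
      refine Finset.sum_congr rfl fun e he => ?_
      rw [← (Finset.mem_filter.mp he).2, ← edgePt_zero]
    rw [Finset.sum_sub_distrib, h1, h0, ← Finset.sum_sub_distrib]
    refine Finset.sum_eq_zero fun v _ => ?_
    rw [← mul_sub, sub_eq_zero.mpr (sub_eq_zero.mp ((mem_eigenspace.mp h).kirchhoff v)).symm,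
      mul_zero]
  have hz := (Finset.sum_eq_zero_iff_of_nonneg fun e _ => sub_nonneg.mpr
    (hmono e (Γ.zero_mem e) (Γ.len_mem e) (Γ.len_pos e).le)).mp hsum e (Finset.mem_univ e)
  have hconst : ∀ s ∈ Icc 0 (Γ.len e), W e s = W e 0 := fun s hs =>
    le_antisymm ((hmono e hs (Γ.len_mem e) hs.2).trans (sub_eq_zero.mp hz).le)
      (hmono e (Γ.zero_mem e) hs hs.1)
  have hd0 : HasDerivWithinAt (W e) 0 (Icc 0 (Γ.len e)) t :=
    (hasDerivWithinAt_const t _ (W e 0)).congr_of_mem hconst ht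
  exact (uniqueDiffOn_Icc (Γ.len_pos e) t ht).eq_deriv _ (hd e t ht) hd0

theorem eigenspace_eq_bot_of_neg [Fintype V] (Γ : MetricGraph V E) (hμ : μ < 0) :
    Γ.eigenspace μ = ⊥ := by
  refine (Submodule.eq_bot_iff _).mpr fun f hf => funext <| Γ.forall_point fun e t ht => ?_
  have := energy_eq_zero hf hμ.le e ht
  have h2 : f (Γ.edgePt e t) ^ 2 = 0 := by
    nlinarith [sq_nonneg (Γ.edgeDeriv f e t), sq_nonneg (f (Γ.edgePt e t))]
  exact pow_eq_zero_iff two_ne_zero |>.mp h2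

theorem one_mem_eigenspace_zero (Γ : MetricGraph V E) : (1 : Γ.Point → ℝ) ∈ Γ.eigenspace 0 := by
  have : (1 : Γ.Point → ℝ) = Γ.ofEdges 1 1 := funext fun p => by cases p <;> rfl
  rw [this]
  exact ofEdges_mem_eigenspace (ψ := 0) (fun _ => rfl) (fun _ => rfl)
    (fun e t => hasDerivAt_const t 1) (fun e t => by simp)
    (by simp)

theorem eigenspace_zero [Fintype V] (hΓ : Γ.toSimpleGraph.Connected) :
    Γ.eigenspace 0 = Submodule.span ℝ {1} := by
  refine le_antisymm (fun f hf => ?_)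
    ((Submodule.span_singleton_le_iff_mem _ _).mpr Γ.one_mem_eigenspace_zero)
  have hD : ∀ e, ∀ t ∈ Icc 0 (Γ.len e), Γ.edgeDeriv f e t = 0 := fun e t ht => by
    simpa using energy_eq_zero hf le_rfl e ht
  have hedge : ∀ e, ∀ t ∈ Icc 0 (Γ.len e), f (Γ.edgePt e t) = f (.vertex (Γ.src e)) := by
    intro e t ht
    rw [← edgePt_zero]
    exact constant_of_derivWithin_zero ((mem_eigenspace.mp hf).differentiableOn e)
      (fun s hs => hD e s (Ico_subset_Icc_self hs)) t ht
  have hend : ∀ e, f (.vertex (Γ.tgt e)) = f (.vertex (Γ.src e)) := fun e => by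
    rw [← hedge e _ (Γ.len_mem e), edgePt_len]
  have hadj : ∀ v w, Γ.toSimpleGraph.Adj v w → f (.vertex v) = f (.vertex w) := by
    intro v w hvw
    rw [toSimpleGraph, SimpleGraph.fromRel_adj] at hvw
    obtain ⟨-, ⟨e, rfl, rfl⟩ | ⟨e, rfl, rfl⟩⟩ := hvw
    · exact (hend e).symm
    · exact hend e
  have hvert : ∀ v w, f (.vertex v) = f (.vertex w) := by
    intro v w
    obtain ⟨p⟩ := hΓ.preconnected v w
    induction p with
    | nil => rfl
    | cons hvw _ ih => exact (hadj _ _ hvw).trans ih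
  obtain ⟨v⟩ := hΓ.nonempty
  refine Submodule.mem_span_singleton.mpr ⟨f (.vertex v), funext <| Γ.forall_point fun e t ht => ?_⟩
  rw [hedge e t ht, hvert (Γ.src e) v]
  simp

theorem eigenspace_disjoint {ν : ℝ} (hμν : μ ≠ ν) (h : f ∈ Γ.eigenspace μ)
    (h' : f ∈ Γ.eigenspace ν) : f = 0 := by
  refine funext <| Γ.forall_point fun e t ht => ?_
  have := (uniqueDiffOn_Icc (Γ.len_pos e) t ht).eq_deriv _ (hasDerivWithinAt_edgeDeriv h e ht)
    (hasDerivWithinAt_edgeDeriv h' e ht)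
  have : (μ - ν) * f (Γ.edgePt e t) = 0 := by linarith
  exact (mul_eq_zero.mp this).resolve_left (sub_ne_zero.mpr hμν)

/-- The second eigenvalue of a connected metric graph is its smallest positive eigenvalue. -/
theorem eigenvalue_two [Fintype V] (hΓ : Γ.toSimpleGraph.Connected) (hμ : 0 < μ)
    (hne : Γ.eigenspace μ ≠ ⊥) (hlt : ∀ ν, 0 < ν → ν < μ → Γ.eigenspace ν = ⊥) :
    Γ.eigenvalue 2 = μ := by
  have : {ν : ℝ | ((2 : ℕ) : Cardinal) ≤
      Module.rank ℝ ↥(⨆ (κ : ℝ) (_ : κ ≤ ν), Γ.eigenspace κ)} = Ici μ := by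
    ext ν
    rw [mem_ofPred_eq, mem_Ici]
    constructor
    · contrapose!
      intro hν
      have hle : (⨆ (κ : ℝ) (_ : κ ≤ ν), Γ.eigenspace κ) ≤ Submodule.span ℝ {1} := by
        refine iSup₂_le fun κ hκ => ?_
        rcases lt_trichotomy κ 0 with h | rfl | h
        · rw [Γ.eigenspace_eq_bot_of_neg h]; exact bot_le
        · exact (eigenspace_zero hΓ).le
        · rw [hlt κ h (hκ.trans_lt hν)]; exact bot_le
      refine ((Submodule.rank_mono hle).trans (rank_span_le _)).trans_lt ?_
      rw [Cardinal.mk_singleton]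
      exact_mod_cast one_lt_two
    · intro hν
      obtain ⟨f, hf, hf0⟩ := Submodule.exists_mem_ne_zero_of_ne_bot hne
      have h1 : (1 : Γ.Point → ℝ) ∈ ⨆ (κ : ℝ) (_ : κ ≤ ν), Γ.eigenspace κ :=
        le_iSup₂_of_le (f := fun (κ : ℝ) (_ : κ ≤ ν) => Γ.eigenspace κ) 0 (hμ.le.trans hν) le_rfl
          Γ.one_mem_eigenspace_zero
      have h2 : f ∈ ⨆ (κ : ℝ) (_ : κ ≤ ν), Γ.eigenspace κ :=
        le_iSup₂_of_le (f := fun (κ : ℝ) (_ : κ ≤ ν) => Γ.eigenspace κ) μ hν le_rfl hf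
      have hli : LinearIndependent ℝ ![(⟨f, h2⟩ : ↥(⨆ (κ : ℝ) (_ : κ ≤ ν), Γ.eigenspace κ)),
          ⟨1, h1⟩] := by
        rw [LinearIndependent.pair_iff]
        intro a b hab
        have hab' : a • f + b • (1 : Γ.Point → ℝ) = 0 := congrArg Subtype.val hab
        have ha : a • f = 0 := by
          refine eigenspace_disjoint hμ.ne' ((Γ.eigenspace μ).smul_mem a hf) ?_
          rw [eq_neg_of_add_eq_zero_left hab']
          exact neg_mem (Submodule.smul_mem _ b Γ.one_mem_eigenspace_zero)
        have ha0 : a = 0 := (smul_eq_zero.mp ha).resolve_right hf0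
        refine ⟨ha0, ?_⟩
        rw [ha, zero_add] at hab'
        obtain ⟨v⟩ := hΓ.nonempty
        simpa using congrFun hab' (.vertex v)
      simpa using hli.cardinal_le_rank
  rw [eigenvalue, this, csInf_Ici]

/-- Along an edge, an eigenfunction for `k²` is a combination of `cos (k t)` and `sin (k t)`. -/
theorem edge_formula {k : ℝ} (hk : k ≠ 0) (h : f ∈ Γ.eigenspace (k ^ 2)) (e : E) {t : ℝ}
    (ht : t ∈ Icc 0 (Γ.len e)) :
    f (Γ.edgePt e t) = f (.vertex (Γ.src e)) * Real.cos (k * t)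
        + Γ.edgeDeriv f e 0 / k * Real.sin (k * t) ∧
      Γ.edgeDeriv f e t = k * (-(f (.vertex (Γ.src e)) * Real.sin (k * t))
        + Γ.edgeDeriv f e 0 / k * Real.cos (k * t)) := by
  have hcos : ∀ s, HasDerivAt (fun s => Real.cos (k * s)) (-Real.sin (k * s) * k) s := fun s => by
    simpa using ((hasDerivAt_id s).const_mul k).cos
  have hsin : ∀ s, HasDerivAt (fun s => Real.sin (k * s)) (Real.cos (k * s) * k) s := fun s => by
    simpa using ((hasDerivAt_id s).const_mul k).sin
  -- Rotating `(f, f' / k)` by the angle `-k s` gives two first integrals.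
  have const : ∀ {G : ℝ → ℝ}, (∀ s ∈ Icc 0 (Γ.len e),
      HasDerivWithinAt G 0 (Icc 0 (Γ.len e)) s) → G t = G 0 := fun {G} hG =>
    constant_of_derivWithin_zero (fun s hs => (hG s hs).differentiableWithinAt)
      (fun s hs => (hG s (Ico_subset_Icc_self hs)).derivWithin
        (uniqueDiffOn_Icc (Γ.len_pos e) s (Ico_subset_Icc_self hs))) t ht
  have h1 := const (G := fun s => f (Γ.edgePt e s) * Real.cos (k * s)
      - Γ.edgeDeriv f e s / k * Real.sin (k * s)) fun s hs => by
    refine (((hasDerivWithinAt_edge h e hs).mul (hcos s).hasDerivWithinAt).sub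
      (((hasDerivWithinAt_edgeDeriv h e hs).div_const k).mul
        (hsin s).hasDerivWithinAt)).congr_deriv ?_
    field_simp
    ring
  have h2 := const (G := fun s => f (Γ.edgePt e s) * Real.sin (k * s)
      + Γ.edgeDeriv f e s / k * Real.cos (k * s)) fun s hs => by
    refine (((hasDerivWithinAt_edge h e hs).mul (hsin s).hasDerivWithinAt).add
      (((hasDerivWithinAt_edgeDeriv h e hs).div_const k).mul
        (hcos s).hasDerivWithinAt)).congr_deriv ?_
    field_simp
    ring
  simp only [mul_zero, Real.cos_zero, Real.sin_zero, mul_one, sub_zero, zero_add,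
    edgePt_zero] at h1 h2
  have hcs := Real.sin_sq_add_cos_sq (k * t)
  rw [← h1, ← h2]
  constructor
  · linear_combination -f (Γ.edgePt e t) * hcs
  · field_simp
    linear_combination -Γ.edgeDeriv f e t * hcs

end Eigenfunctions

end MetricGraph

namespace MetricGraph

/-! ### Eigenfunctions on a 3-star -/

section Stars

variable {V E : Type} {Γ : MetricGraph V E} {f : Γ.Point → ℝ} {a : ℝ} {e e₁ e₂ : E}

/-- The edges `e`, `e₁`, `e₂` of length `a` form a `3`-star whose centre is the end of `e`, and `f`
satisfies the Kirchhoff conditions at the centre and at the ends of `e₁` and `e₂`. -/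
structure IsStar (Γ : MetricGraph V E) (f : Γ.Point → ℝ) (a : ℝ) (e e₁ e₂ : E) : Prop where
  len : Γ.len e = a
  len₁ : Γ.len e₁ = a
  len₂ : Γ.len e₂ = a
  src₁ : Γ.src e₁ = Γ.tgt e
  src₂ : Γ.src e₂ = Γ.tgt e
  centre : Γ.edgeDeriv f e a = Γ.edgeDeriv f e₁ 0 + Γ.edgeDeriv f e₂ 0
  leaf₁ : Γ.edgeDeriv f e₁ a = 0
  leaf₂ : Γ.edgeDeriv f e₂ a = 0

theorem IsStar.swap (hs : Γ.IsStar f a e e₁ e₂) : Γ.IsStar f a e e₂ e₁ where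
  len := hs.len
  len₁ := hs.len₂
  len₂ := hs.len₁
  src₁ := hs.src₂
  src₂ := hs.src₁
  centre := by rw [hs.centre, add_comm]
  leaf₁ := hs.leaf₂
  leaf₂ := hs.leaf₁

variable [Fintype E] [DecidableEq V] {k : ℝ}

/-- An eigenfunction on an edge that ends in a leaf. -/
theorem pendant_formula (hk : k ≠ 0) (h : f ∈ Γ.eigenspace (k ^ 2)) {e : E}
    (hleaf : Γ.edgeDeriv f e (Γ.len e) = 0) :
    Real.cos (k * Γ.len e) * (Γ.edgeDeriv f e 0 / k)
        = f (.vertex (Γ.src e)) * Real.sin (k * Γ.len e) ∧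
      ∀ t ∈ Icc 0 (Γ.len e), Real.cos (k * Γ.len e) * f (Γ.edgePt e t)
        = f (.vertex (Γ.src e)) * Real.cos (k * Γ.len e - k * t) := by
  have h1 := (edge_formula hk h e (Γ.len_mem e)).2
  rw [hleaf, eq_comm, mul_eq_zero, or_iff_right hk] at h1
  refine ⟨by linear_combination h1, fun t ht => ?_⟩
  rw [(edge_formula hk h e ht).1, Real.cos_sub]
  linear_combination Real.sin (k * t) * h1

theorem IsStar.leaf_formula (hs : Γ.IsStar f a e e₁ e₂) (hk : k ≠ 0)
    (h : f ∈ Γ.eigenspace (k ^ 2)) {t : ℝ} (ht : t ∈ Icc 0 a) :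
    Real.cos (k * a) * f (Γ.edgePt e₁ t)
      = (f (.vertex (Γ.src e)) * Real.cos (k * a)
        + Γ.edgeDeriv f e 0 / k * Real.sin (k * a)) * Real.cos (k * a - k * t) := by
  have h1 := (pendant_formula hk h (by rw [hs.len₁]; exact hs.leaf₁)).2 t (by rwa [hs.len₁])
  rw [hs.len₁, hs.src₁, ← edgePt_len, (edge_formula hk h e (Γ.len_mem e)).1, hs.len] at h1
  exact h1

/-- The Dirichlet-to-Neumann relation of the `3`-star at the free end of `e`. -/
theorem IsStar.relation (hs : Γ.IsStar f a e e₁ e₂) (hk : k ≠ 0)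
    (h : f ∈ Γ.eigenspace (k ^ 2)) :
    Γ.edgeDeriv f e 0 / k * (1 - 3 * Real.sin (k * a) ^ 2)
      = 3 * Real.sin (k * a) * Real.cos (k * a) * f (.vertex (Γ.src e)) := by
  have h1 := (pendant_formula hk h (by rw [hs.len₁]; exact hs.leaf₁)).1
  have h2 := (pendant_formula hk h (by rw [hs.len₂]; exact hs.leaf₂)).1
  obtain ⟨h3, h4⟩ := edge_formula hk h e (Γ.len_mem e)
  rw [hs.len₁, hs.src₁, ← edgePt_len, h3, hs.len] at h1
  rw [hs.len₂, hs.src₂, ← edgePt_len, h3, hs.len] at h2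
  rw [hs.len, hs.centre] at h4
  have h5 : Γ.edgeDeriv f e₁ 0 / k + Γ.edgeDeriv f e₂ 0 / k
      = -(f (.vertex (Γ.src e)) * Real.sin (k * a))
        + Γ.edgeDeriv f e 0 / k * Real.cos (k * a) := by
    rw [← add_div, h4, mul_div_cancel_left₀ _ hk]
  linear_combination h1 + h2 - Real.cos (k * a) * h5
    - Γ.edgeDeriv f e 0 / k * Real.sin_sq_add_cos_sq (k * a)

/-- Below the first Dirichlet eigenvalue of the star, the outgoing derivative at the free end of
`e` has the same sign as the value there. -/
theorem IsStar.sign (hs : Γ.IsStar f a e e₁ e₂) (hk : k ≠ 0) (h : f ∈ Γ.eigenspace (k ^ 2))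
    (hsin : 0 < Real.sin (k * a)) (hcos : 0 < Real.cos (k * a))
    (hlt : 3 * Real.sin (k * a) ^ 2 < 1) :
    ∃ c > 0, Γ.edgeDeriv f e 0 / k = c * f (.vertex (Γ.src e)) := by
  have h1 : 0 < 1 - 3 * Real.sin (k * a) ^ 2 := by linarith
  refine ⟨3 * Real.sin (k * a) * Real.cos (k * a) / (1 - 3 * Real.sin (k * a) ^ 2),
    by positivity, ?_⟩
  rw [div_mul_eq_mul_div, ← hs.relation hk h, mul_div_cancel_right₀ _ h1.ne']

theorem IsStar.eq_zero_stem (hs : Γ.IsStar f a e e₁ e₂) (hk : k ≠ 0)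
    (h : f ∈ Γ.eigenspace (k ^ 2)) (hx : f (.vertex (Γ.src e)) = 0)
    (hq : Γ.edgeDeriv f e 0 / k = 0) {t : ℝ} (ht : t ∈ Icc 0 a) : f (Γ.edgePt e t) = 0 := by
  rw [(edge_formula hk h e (by rwa [hs.len])).1, hx, hq, zero_mul, zero_mul, add_zero]

theorem IsStar.eq_zero_leaf (hs : Γ.IsStar f a e e₁ e₂) (hk : k ≠ 0)
    (h : f ∈ Γ.eigenspace (k ^ 2)) (hcos : Real.cos (k * a) ≠ 0)
    (hx : f (.vertex (Γ.src e)) = 0) (hq : Γ.edgeDeriv f e 0 / k = 0)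
    {t : ℝ} (ht : t ∈ Icc 0 a) : f (Γ.edgePt e₁ t) = 0 := by
  have := hs.leaf_formula hk h ht
  rw [hx, hq, zero_mul, zero_mul, add_zero, zero_mul] at this
  exact (mul_eq_zero.mp this).resolve_left hcos

end Stars

end MetricGraph

namespace HotSpots

open MetricGraph

instance : Fintype StarVertex where
  elems := {.v0, .cu, .cd, .u1, .u2, .d1, .d2}
  complete x := by cases x <;> decide

instance : Fintype TreeVertex where
  elems := {.v0, .vl, .vr, .cu, .cd, .u1, .u2, .d1, .d2}
  complete x := by cases x <;> decide

/-! ### The tree as a metric space -/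

section Geometry

variable (ε : ℝ) (hε : ε < 1 / 2)

theorem starSquare_connected : (starSquare ε hε).toSimpleGraph.Connected := by
  have hadj : ∀ e, (starSquare ε hε).toSimpleGraph.Reachable
      ((starSquare ε hε).src e) ((starSquare ε hε).tgt e) := fun e =>
    ((starSquare ε hε).adj_of_edge (by cases e <;> simp [starSquare])).reachable
  refine SimpleGraph.connected_iff_exists_forall_reachable _ |>.mpr ⟨.v0, fun v => ?_⟩
  cases v
  exacts [.refl _, hadj .su, hadj .sd, (hadj .su).trans (hadj .u1), (hadj .su).trans (hadj .u2),
    (hadj .sd).trans (hadj .d1), (hadj .sd).trans (hadj .d2)]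

theorem tree_src_ne_tgt (e : TreeEdge) : (tree ε hε).src e ≠ (tree ε hε).tgt e := by
  cases e <;> simp [tree]

theorem tree_connected : (tree ε hε).toSimpleGraph.Connected := by
  have hadj : ∀ e, (tree ε hε).toSimpleGraph.Reachable
      ((tree ε hε).src e) ((tree ε hε).tgt e) := fun e =>
    ((tree ε hε).adj_of_edge (tree_src_ne_tgt ε hε e)).reachable
  refine SimpleGraph.connected_iff_exists_forall_reachable _ |>.mpr ⟨.v0, fun v => ?_⟩
  cases v
  exacts [.refl _, hadj .l, hadj .r, hadj .su, hadj .sd, (hadj .su).trans (hadj .u1),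
    (hadj .su).trans (hadj .u2), (hadj .sd).trans (hadj .d1), (hadj .sd).trans (hadj .d2)]

theorem tree_isTree : (tree ε hε).IsTree := by
  refine (tree ε hε).isTree_of_card (tree_src_ne_tgt ε hε) ?_ (tree_connected ε hε) ?_
  · intro e e' h
    cases e <;> cases e' <;> simp [tree] at h ⊢
  · rw [Nat.card_eq_fintype_card, Nat.card_eq_fintype_card]
    rfl

variable {ε} {hε}

/-- The centre `v0` is at distance at most `1` of every point, with equality at the ends of the
path only. -/
theorem edist_v0 (h0 : 0 < ε) (p : (tree ε hε).Point) :
    edist (.vertex .v0 : (tree ε hε).Point) p < 1 ∨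
      (edist (.vertex .v0 : (tree ε hε).Point) p ≤ 1 ∧ (p = .vertex .vl ∨ p = .vertex .vr)) := by
  have hstem : ∀ (e : TreeEdge), (tree ε hε).src e = .v0 → ∀ t ∈ Icc 0 ((tree ε hε).len e),
      edist (.vertex .v0 : (tree ε hε).Point) ((tree ε hε).edgePt e t) ≤ ENNReal.ofReal t := by
    intro e he t ht
    have := (tree ε hε).edist_edgePt_le e ((tree ε hε).zero_mem e) ht
    rwa [edgePt_zero, he, zero_sub, abs_neg, abs_of_nonneg ht.1] at this
  have hpath : ∀ e : TreeEdge, (tree ε hε).src e = .v0 → (tree ε hε).len e = 1 →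
      ∀ t ∈ Icc 0 ((tree ε hε).len e),
      edist (.vertex .v0 : (tree ε hε).Point) ((tree ε hε).edgePt e t) < 1 ∨
      edist (.vertex .v0 : (tree ε hε).Point) ((tree ε hε).edgePt e t) ≤ 1 ∧
        (tree ε hε).edgePt e t = .vertex ((tree ε hε).tgt e) := by
    intro e he hl t ht
    have h1 := hstem e he t ht
    rcases ht.2.eq_or_lt with rfl | h
    · right
      rw [hl, ENNReal.ofReal_one] at h1
      rw [hl]
      exact ⟨h1, by rw [← hl, edgePt_len]⟩
    · left
      refine h1.trans_lt (ENNReal.ofReal_lt_one.mpr (by rwa [hl] at h))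
  have hshort : ∀ e : TreeEdge, (tree ε hε).src e = .v0 → (tree ε hε).len e = 1 / 2 - ε →
      ∀ t ∈ Icc 0 ((tree ε hε).len e),
      edist (.vertex .v0 : (tree ε hε).Point) ((tree ε hε).edgePt e t) < 1 := by
    intro e he hl t ht
    refine (hstem e he t ht).trans_lt (ENNReal.ofReal_lt_one.mpr ?_)
    have := ht.2
    rw [hl] at this
    linarith
  have hleaf : ∀ e e' : TreeEdge, (tree ε hε).src e = .v0 → (tree ε hε).len e = 1 / 2 - ε →
      (tree ε hε).len e' = 1 / 2 - ε → (tree ε hε).tgt e = (tree ε hε).src e' →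
      ∀ t ∈ Icc 0 ((tree ε hε).len e'),
      edist (.vertex .v0 : (tree ε hε).Point) ((tree ε hε).edgePt e' t) < 1 := by
    intro e e' he hl hl' hee t ht
    have h1 := hstem e he _ ((tree ε hε).len_mem e)
    have h2 := (tree ε hε).edist_edgePt_le e' ((tree ε hε).zero_mem e') ht
    rw [edgePt_zero, ← hee, ← edgePt_len, zero_sub, abs_neg, abs_of_nonneg ht.1] at h2
    refine (edist_triangle _ _ _).trans_lt ((add_le_add h1 h2).trans_lt ?_)
    rw [← ENNReal.ofReal_add ((tree ε hε).len_pos e).le ht.1, ENNReal.ofReal_lt_one, hl]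
    have := ht.2
    rw [hl'] at this
    linarith
  revert p
  refine (tree ε hε).forall_point fun e t ht => ?_
  cases e
  · exact (hpath .l rfl rfl t ht).imp_right fun h => ⟨h.1, .inl h.2⟩
  · exact (hpath .r rfl rfl t ht).imp_right fun h => ⟨h.1, .inr h.2⟩
  · exact .inl (hshort .su rfl rfl t ht)
  · exact .inl (hshort .sd rfl rfl t ht)
  · exact .inl (hleaf .su .u1 rfl rfl rfl rfl t ht)
  · exact .inl (hleaf .su .u2 rfl rfl rfl rfl t ht)
  · exact .inl (hleaf .sd .d1 rfl rfl rfl rfl t ht)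
  · exact .inl (hleaf .sd .d2 rfl rfl rfl rfl t ht)

theorem edist_v0_le (h0 : 0 < ε) (p : (tree ε hε).Point) :
    edist (.vertex .v0 : (tree ε hε).Point) p ≤ 1 :=
  (edist_v0 h0 p).elim le_of_lt And.left

theorem edist_le_two (h0 : 0 < ε) (p q : (tree ε hε).Point) : edist p q ≤ 2 := by
  refine (edist_triangle_left p q (.vertex .v0)).trans ?_
  rw [← one_add_one_eq_two]
  exact add_le_add (edist_v0_le h0 p) (edist_v0_le h0 q)

theorem edist_vl_vr (h0 : 0 < ε) :
    edist (.vertex .vl : (tree ε hε).Point) (.vertex .vr) = 2 := by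
  refine le_antisymm (edist_le_two h0 _ _) ?_
  -- The signed coordinate along the path, extended by zero to the stars, is 1-Lipschitz.
  let val : TreeVertex → ℝ
    | .vl => -1
    | .vr => 1
    | _ => 0
  let φ : TreeEdge → ℝ → ℝ
    | .l, t => -t
    | .r, t => t
    | _, _ => 0
  have hφ0 : ∀ e, φ e 0 = val ((tree ε hε).src e) := by
    intro e; cases e <;> simp [φ, val, tree]
  have hφ1 : ∀ e, φ e ((tree ε hε).len e) = val ((tree ε hε).tgt e) := by
    intro e; cases e <;> simp [φ, val, tree]
  have hlip : LipschitzWith 1 ((tree ε hε).ofEdges val φ) := by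
    refine (tree ε hε).lipschitzWith_one fun e s hs t ht => ?_
    rw [ofEdges_edgePt hφ0 hφ1 e hs, ofEdges_edgePt hφ0 hφ1 e ht]
    cases e
    case l =>
      simp only [φ]
      rw [neg_sub_neg, abs_sub_comm]
    case r => exact le_rfl
    all_goals simp [φ]
  have := hlip (.vertex .vl) (.vertex .vr)
  rw [ENNReal.coe_one, one_mul, edist_dist, Real.dist_eq] at this
  refine le_trans ?_ this
  have h2 : |(tree ε hε).ofEdges val φ (.vertex .vl) - (tree ε hε).ofEdges val φ (.vertex .vr)|
      = 2 := by
    change |(-1 : ℝ) - 1| = 2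
    norm_num
  rw [h2]
  simp

theorem ediam_tree (h0 : 0 < ε) : Metric.ediam (univ : Set (tree ε hε).Point) = 2 := by
  refine le_antisymm (Metric.ediam_le fun p _ q _ => edist_le_two h0 p q) ?_
  rw [← edist_vl_vr h0]
  exact Metric.edist_le_ediam_of_mem (mem_univ _) (mem_univ _)

theorem edist_eq_two_iff (h0 : 0 < ε) (p q : (tree ε hε).Point) :
    edist p q = 2 ↔ (p = .vertex .vl ∧ q = .vertex .vr) ∨ (p = .vertex .vr ∧ q = .vertex .vl) := by
  constructor
  · intro h
    have htri := edist_triangle_left p q (.vertex .v0 : (tree ε hε).Point)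
    rw [h] at htri
    have hp := edist_v0_le h0 p
    have hq := edist_v0_le h0 q
    have h2 : (2 : ℝ≥0∞) = 1 + 1 := one_add_one_eq_two.symm
    rcases edist_v0 h0 p with hp' | ⟨-, hp'⟩
    · have := ENNReal.add_lt_add_of_lt_of_le (hq.trans_lt ENNReal.one_lt_top).ne hp' hq
      exact absurd (htri.trans_lt this) (by rw [h2]; exact lt_irrefl _)
    rcases edist_v0 h0 q with hq' | ⟨-, hq'⟩
    · have := ENNReal.add_lt_add_of_le_of_lt (hp.trans_lt ENNReal.one_lt_top).ne hp hq'
      exact absurd (htri.trans_lt this) (by rw [h2]; exact lt_irrefl _)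
    rcases hp' with rfl | rfl <;> rcases hq' with rfl | rfl
    · simp at h
    · exact .inl ⟨rfl, rfl⟩
    · exact .inr ⟨rfl, rfl⟩
    · simp at h
  · rintro (⟨rfl, rfl⟩ | ⟨rfl, rfl⟩)
    · exact edist_vl_vr h0
    · rw [edist_comm, edist_vl_vr h0]

end Geometry

end HotSpots

namespace HotSpots

open MetricGraph

section Spectrum

/-! ### The Dirichlet ground state of the 3-star -/

/-- The angle `θ` with `sin θ = 1 / √3`: the first Dirichlet eigenvalue of the `3`-star with edge
length `a` is `(θ / a)²`. -/
noncomputable def starAngle : ℝ := Real.arcsin √(1 / 3)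

theorem three_mul_sin_sq_starAngle : 3 * Real.sin starAngle ^ 2 = 1 := by
  have h : √(1 / 3 : ℝ) ≤ 1 := Real.sqrt_le_one.mpr (by norm_num)
  rw [starAngle, Real.sin_arcsin (by linarith [Real.sqrt_nonneg (1 / 3 : ℝ)]) h,
    Real.sq_sqrt (by norm_num)]
  norm_num

theorem starAngle_pos : 0 < starAngle :=
  Real.arcsin_pos.mpr (Real.sqrt_pos.mpr (by norm_num))

theorem starAngle_lt : starAngle < Real.pi / 4 := by
  by_contra! h
  have h1 : Real.sin (Real.pi / 4) ≤ Real.sin starAngle :=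
    Real.sin_le_sin_of_le_of_le_pi_div_two (by linarith [Real.pi_pos])
      (Real.arcsin_le_pi_div_two _) h
  have h2 : Real.sin (Real.pi / 4) ^ 2 = 1 / 2 := by
    rw [Real.sin_pi_div_four, div_pow, Real.sq_sqrt (by norm_num)]
    norm_num
  have h3 : 0 ≤ Real.sin (Real.pi / 4) := by rw [Real.sin_pi_div_four]; positivity
  nlinarith [three_mul_sin_sq_starAngle]

theorem sin_pos_of_le {τ : ℝ} (h0 : 0 < τ) (h1 : τ ≤ starAngle) : 0 < Real.sin τ :=
  Real.sin_pos_of_pos_of_lt_pi h0 (by linarith [starAngle_lt, Real.pi_pos])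

theorem cos_pos_of_le {τ : ℝ} (h0 : 0 ≤ τ) (h1 : τ ≤ starAngle) : 0 < Real.cos τ :=
  Real.cos_pos_of_mem_Ioo ⟨by linarith [Real.pi_pos], by linarith [starAngle_lt, Real.pi_pos]⟩

theorem three_mul_sin_sq_lt {τ : ℝ} (h0 : 0 < τ) (h1 : τ < starAngle) :
    3 * Real.sin τ ^ 2 < 1 := by
  rw [← three_mul_sin_sq_starAngle]
  have h2 := Real.sin_lt_sin_of_lt_of_le_pi_div_two (by linarith [Real.pi_pos])
    (Real.arcsin_le_pi_div_two _) h1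
  have h3 := sin_pos_of_le h0 h1.le
  change Real.sin τ < Real.sin starAngle at h2
  nlinarith

theorem cos_sq_starAngle : Real.cos starAngle ^ 2 = 2 * Real.sin starAngle ^ 2 := by
  linarith [Real.sin_sq_add_cos_sq starAngle, three_mul_sin_sq_starAngle]

/-- The first Dirichlet eigenfunction of the `3`-star, vanishing at the free end of the stem,
on the stem with parameter `t = 0` at the free end. It is scaled so that its value at the two
leaves is `sin θ`, and `k = θ / a`. -/
noncomputable def stemProfile (k t : ℝ) : ℝ := Real.cos starAngle * Real.sin (k * t)

/-- The first Dirichlet eigenfunction of the `3`-star on the two other edges. -/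
noncomputable def leafProfile (k t : ℝ) : ℝ := Real.sin starAngle * Real.cos (starAngle - k * t)

theorem hasDerivAt_stemProfile (k t : ℝ) :
    HasDerivAt (stemProfile k) (k * (Real.cos starAngle * Real.cos (k * t))) t := by
  refine (((hasDerivAt_id t).const_mul k).sin.const_mul (Real.cos starAngle)).congr_deriv ?_
  simp only [id, mul_one]; ring

theorem hasDerivAt_stemProfile_deriv (k t : ℝ) :
    HasDerivAt (fun t => k * (Real.cos starAngle * Real.cos (k * t)))
      (-(k ^ 2 * stemProfile k t)) t := by
  refine ((((hasDerivAt_id t).const_mul k).cos.const_mul (Real.cos starAngle)).const_mul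
    k).congr_deriv ?_
  simp only [id, mul_one, stemProfile]; ring

theorem hasDerivAt_leafProfile (k t : ℝ) :
    HasDerivAt (leafProfile k) (k * (Real.sin starAngle * Real.sin (starAngle - k * t))) t := by
  refine ((((hasDerivAt_id t).const_mul k).const_sub starAngle).cos.const_mul
    (Real.sin starAngle)).congr_deriv ?_
  simp only [id, mul_one]; ring

theorem hasDerivAt_leafProfile_deriv (k t : ℝ) :
    HasDerivAt (fun t => k * (Real.sin starAngle * Real.sin (starAngle - k * t)))
      (-(k ^ 2 * leafProfile k t)) t := by
  refine (((((hasDerivAt_id t).const_mul k).const_sub starAngle).sin.const_mul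
    (Real.sin starAngle)).const_mul k).congr_deriv ?_
  simp only [id, mul_one, leafProfile]; ring

variable {ε : ℝ} {hε : ε < 1 / 2}

/-! ### The Kirchhoff conditions on the two graphs -/

theorem sum_starEdge (g : StarEdge → ℝ) :
    ∑ e, g e = g .su + g .sd + g .u1 + g .u2 + g .d1 + g .d2 := by
  change ∑ e ∈ ({.su, .sd, .u1, .u2, .d1, .d2} : Finset StarEdge), g e = _
  simp [add_assoc]

theorem sum_treeEdge (g : TreeEdge → ℝ) :
    ∑ e, g e = g .l + g .r + g .su + g .sd + g .u1 + g .u2 + g .d1 + g .d2 := by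
  change ∑ e ∈ ({.l, .r, .su, .sd, .u1, .u2, .d1, .d2} : Finset TreeEdge), g e = _
  simp [add_assoc]

/-- The Kirchhoff conditions on the two stars, for prescribed derivatives `ψ₀` at the initial
and `ψ₁` at the final points of the edges. -/
theorem starSquare_kirchhoff_iff (ψ₀ ψ₁ : StarEdge → ℝ) :
    (∀ v, (∑ e with (starSquare ε hε).src e = v, ψ₀ e)
        - (∑ e with (starSquare ε hε).tgt e = v, ψ₁ e) = 0) ↔
      (ψ₀ .su + ψ₀ .sd = 0 ∧ ψ₁ .su = ψ₀ .u1 + ψ₀ .u2 ∧ ψ₁ .sd = ψ₀ .d1 + ψ₀ .d2) ∧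
      ψ₁ .u1 = 0 ∧ ψ₁ .u2 = 0 ∧ ψ₁ .d1 = 0 ∧ ψ₁ .d2 = 0 := by
  have key : ∀ v, (∑ e with (starSquare ε hε).src e = v, ψ₀ e)
        - (∑ e with (starSquare ε hε).tgt e = v, ψ₁ e) = match v with
      | .v0 => ψ₀ .su + ψ₀ .sd
      | .cu => ψ₀ .u1 + ψ₀ .u2 - ψ₁ .su
      | .cd => ψ₀ .d1 + ψ₀ .d2 - ψ₁ .sd
      | .u1 => -ψ₁ .u1
      | .u2 => -ψ₁ .u2
      | .d1 => -ψ₁ .d1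
      | .d2 => -ψ₁ .d2 := by
    intro v
    simp only [Finset.sum_filter, sum_starEdge]
    cases v <;> simp [starSquare]
  simp only [key]
  constructor
  · intro h
    have h0 := h .v0; have h1 := h .cu; have h2 := h .cd; have h3 := h .u1
    have h4 := h .u2; have h5 := h .d1; have h6 := h .d2
    simp only at h0 h1 h2 h3 h4 h5 h6
    refine ⟨⟨?_, ?_, ?_⟩, ?_, ?_, ?_, ?_⟩ <;> linarith
  · rintro ⟨⟨h0, h1, h2⟩, h3, h4, h5, h6⟩ v
    cases v <;> simp only <;> linarith

/-- The Kirchhoff conditions on the tree, for prescribed derivatives `ψ₀` at the initial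
and `ψ₁` at the final points of the edges. -/
theorem tree_kirchhoff_iff (ψ₀ ψ₁ : TreeEdge → ℝ) :
    (∀ v, (∑ e with (tree ε hε).src e = v, ψ₀ e)
        - (∑ e with (tree ε hε).tgt e = v, ψ₁ e) = 0) ↔
      (ψ₀ .l + ψ₀ .r + ψ₀ .su + ψ₀ .sd = 0 ∧
        ψ₁ .su = ψ₀ .u1 + ψ₀ .u2 ∧ ψ₁ .sd = ψ₀ .d1 + ψ₀ .d2) ∧
      (ψ₁ .l = 0 ∧ ψ₁ .r = 0) ∧ ψ₁ .u1 = 0 ∧ ψ₁ .u2 = 0 ∧ ψ₁ .d1 = 0 ∧ ψ₁ .d2 = 0 := by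
  have key : ∀ v, (∑ e with (tree ε hε).src e = v, ψ₀ e)
        - (∑ e with (tree ε hε).tgt e = v, ψ₁ e) = match v with
      | .v0 => ψ₀ .l + ψ₀ .r + ψ₀ .su + ψ₀ .sd
      | .vl => -ψ₁ .l
      | .vr => -ψ₁ .r
      | .cu => ψ₀ .u1 + ψ₀ .u2 - ψ₁ .su
      | .cd => ψ₀ .d1 + ψ₀ .d2 - ψ₁ .sd
      | .u1 => -ψ₁ .u1
      | .u2 => -ψ₁ .u2
      | .d1 => -ψ₁ .d1
      | .d2 => -ψ₁ .d2 := by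
    intro v
    simp only [Finset.sum_filter, sum_treeEdge]
    cases v <;> simp [tree]
  simp only [key]
  constructor
  · intro h
    have h0 := h .v0; have h1 := h .cu; have h2 := h .cd; have h3 := h .u1
    have h4 := h .u2; have h5 := h .d1; have h6 := h .d2; have h7 := h .vl; have h8 := h .vr
    simp only at h0 h1 h2 h3 h4 h5 h6 h7 h8
    refine ⟨⟨?_, ?_, ?_⟩, ⟨?_, ?_⟩, ?_, ?_, ?_, ?_⟩ <;> linarith
  · rintro ⟨⟨h0, h1, h2⟩, ⟨h7, h8⟩, h3, h4, h5, h6⟩ v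
    cases v <;> simp only <;> linarith

theorem starSquare_isStar {μ : ℝ} {f : (starSquare ε hε).Point → ℝ}
    (h : f ∈ (starSquare ε hε).eigenspace μ) :
    (starSquare ε hε).IsStar f (1 / 2 - ε) .su .u1 .u2 ∧
      (starSquare ε hε).IsStar f (1 / 2 - ε) .sd .d1 .d2 ∧
      (starSquare ε hε).edgeDeriv f .su 0 + (starSquare ε hε).edgeDeriv f .sd 0 = 0 := by
  obtain ⟨⟨h0, h1, h2⟩, h3, h4, h5, h6⟩ :=
    (starSquare_kirchhoff_iff (hε := hε) _ _).mp (mem_eigenspace.mp h).kirchhoff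
  exact ⟨⟨rfl, rfl, rfl, rfl, rfl, h1, h3, h4⟩, ⟨rfl, rfl, rfl, rfl, rfl, h2, h5, h6⟩, h0⟩

theorem tree_isStar {μ : ℝ} {f : (tree ε hε).Point → ℝ}
    (h : f ∈ (tree ε hε).eigenspace μ) :
    ((tree ε hε).IsStar f (1 / 2 - ε) .su .u1 .u2 ∧
      (tree ε hε).IsStar f (1 / 2 - ε) .sd .d1 .d2) ∧
      ((tree ε hε).edgeDeriv f .l 0 + (tree ε hε).edgeDeriv f .r 0
        + (tree ε hε).edgeDeriv f .su 0 + (tree ε hε).edgeDeriv f .sd 0 = 0) ∧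
      (tree ε hε).edgeDeriv f .l 1 = 0 ∧ (tree ε hε).edgeDeriv f .r 1 = 0 := by
  obtain ⟨⟨h0, h1, h2⟩, ⟨h7, h8⟩, h3, h4, h5, h6⟩ :=
    (tree_kirchhoff_iff (hε := hε) _ _).mp (mem_eigenspace.mp h).kirchhoff
  exact ⟨⟨⟨rfl, rfl, rfl, rfl, rfl, h1, h3, h4⟩, ⟨rfl, rfl, rfl, rfl, rfl, h2, h5, h6⟩⟩, h0, h7, h8⟩

/-! ### No small positive eigenvalues -/

theorem starSquare_eigenspace_eq_bot {k : ℝ} (hk : 0 < k) (hlt : k * (1 / 2 - ε) < starAngle) :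
    (starSquare ε hε).eigenspace (k ^ 2) = ⊥ := by
  have ha : 0 < k * (1 / 2 - ε) := mul_pos hk (by linarith)
  have hsin := sin_pos_of_le ha hlt.le
  have hcos := cos_pos_of_le ha.le hlt.le
  have h3 := three_mul_sin_sq_lt ha hlt
  refine (Submodule.eq_bot_iff _).mpr fun f hf => ?_
  obtain ⟨hu, hd, h0⟩ := starSquare_isStar hf
  obtain ⟨cu, hcu, hqu⟩ := hu.sign hk.ne' hf hsin hcos h3
  obtain ⟨cd, hcd, hqd⟩ := hd.sign hk.ne' hf hsin hcos h3
  change _ = cu * f (.vertex .v0) at hqu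
  change _ = cd * f (.vertex .v0) at hqd
  have h1 : (cu + cd) * f (.vertex .v0) = 0 := by
    rw [add_mul, ← hqu, ← hqd, ← add_div, h0, zero_div]
  have hx : f (.vertex .v0) = 0 := (mul_eq_zero.mp h1).resolve_left (by positivity)
  rw [hx, mul_zero] at hqu hqd
  refine funext <| (starSquare ε hε).forall_point fun e t ht => ?_
  cases e
  · exact hu.eq_zero_stem hk.ne' hf hx hqu ht
  · exact hd.eq_zero_stem hk.ne' hf hx hqd ht
  · exact hu.eq_zero_leaf hk.ne' hf hcos.ne' hx hqu ht
  · exact hu.swap.eq_zero_leaf hk.ne' hf hcos.ne' hx hqu ht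
  · exact hd.eq_zero_leaf hk.ne' hf hcos.ne' hx hqd ht
  · exact hd.swap.eq_zero_leaf hk.ne' hf hcos.ne' hx hqd ht

theorem tree_pendant {k : ℝ} (hk : k ≠ 0) {f : (tree ε hε).Point → ℝ}
    (h : f ∈ (tree ε hε).eigenspace (k ^ 2)) {e : TreeEdge} (he : e = .l ∨ e = .r) :
    Real.cos k * ((tree ε hε).edgeDeriv f e 0 / k) = f (.vertex .v0) * Real.sin k ∧
      ∀ t ∈ Icc (0 : ℝ) 1, Real.cos k * f ((tree ε hε).edgePt e t)
        = f (.vertex .v0) * Real.cos (k - k * t) := by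
  obtain ⟨-, -, hl, hr⟩ := tree_isStar h
  rcases he with rfl | rfl
  · simpa [tree] using pendant_formula hk h (e := .l) hl
  · simpa [tree] using pendant_formula hk h (e := .r) hr

theorem tree_eigenspace_eq_bot {k : ℝ} (hk : 0 < k) (hlt : k * (1 / 2 - ε) < starAngle)
    (hk2 : k < Real.pi / 2) : (tree ε hε).eigenspace (k ^ 2) = ⊥ := by
  have ha : 0 < k * (1 / 2 - ε) := mul_pos hk (by linarith)
  have hsin := sin_pos_of_le ha hlt.le
  have hcos := cos_pos_of_le ha.le hlt.le
  have h3 := three_mul_sin_sq_lt ha hlt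
  have hsk : 0 < Real.sin k := Real.sin_pos_of_pos_of_lt_pi hk (by linarith)
  have hck : 0 < Real.cos k := Real.cos_pos_of_mem_Ioo ⟨by linarith, hk2⟩
  refine (Submodule.eq_bot_iff _).mpr fun f hf => ?_
  obtain ⟨⟨hu, hd⟩, h0, -⟩ := tree_isStar hf
  obtain ⟨hl, hl'⟩ := tree_pendant hk.ne' hf (.inl rfl)
  obtain ⟨hr, hr'⟩ := tree_pendant hk.ne' hf (.inr rfl)
  obtain ⟨cu, hcu, hqu⟩ := hu.sign hk.ne' hf hsin hcos h3
  obtain ⟨cd, hcd, hqd⟩ := hd.sign hk.ne' hf hsin hcos h3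
  change _ = cu * f (.vertex .v0) at hqu
  change _ = cd * f (.vertex .v0) at hqd
  have hsum : (tree ε hε).edgeDeriv f .l 0 / k + (tree ε hε).edgeDeriv f .r 0 / k
      + (tree ε hε).edgeDeriv f .su 0 / k + (tree ε hε).edgeDeriv f .sd 0 / k = 0 := by
    rw [← add_div, ← add_div, ← add_div, h0, zero_div]
  -- The Kirchhoff condition at `v0`, multiplied by `cos k`, is a positive multiple of the value.
  have h1 : (2 * Real.sin k + Real.cos k * (cu + cd)) * f (.vertex .v0) = 0 := by
    linear_combination Real.cos k * hsum - hl - hr - Real.cos k * hqu - Real.cos k * hqd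
  have hx : f (.vertex .v0) = 0 := (mul_eq_zero.mp h1).resolve_left (by positivity)
  rw [hx, mul_zero] at hqu hqd
  refine funext <| (tree ε hε).forall_point fun e t ht => ?_
  cases e
  · have := hl' t ht
    rw [hx, zero_mul] at this
    exact (mul_eq_zero.mp this).resolve_left hck.ne'
  · have := hr' t ht
    rw [hx, zero_mul] at this
    exact (mul_eq_zero.mp this).resolve_left hck.ne'
  · exact hu.eq_zero_stem hk.ne' hf hx hqu ht
  · exact hd.eq_zero_stem hk.ne' hf hx hqd ht
  · exact hu.eq_zero_leaf hk.ne' hf hcos.ne' hx hqu ht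
  · exact hu.swap.eq_zero_leaf hk.ne' hf hcos.ne' hx hqu ht
  · exact hd.eq_zero_leaf hk.ne' hf hcos.ne' hx hqd ht
  · exact hd.swap.eq_zero_leaf hk.ne' hf hcos.ne' hx hqd ht

/-! ### The antisymmetric eigenfunction -/

/-- The square root `θ / a` of the second eigenvalue, where `a = 1 / 2 - ε`. -/
noncomputable def freq (ε : ℝ) : ℝ := starAngle / (1 / 2 - ε)

theorem freq_pos (hε : ε < 1 / 2) : 0 < freq ε := div_pos starAngle_pos (by linarith)

theorem freq_mul (hε : ε < 1 / 2) : freq ε * (1 / 2 - ε) = starAngle :=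
  div_mul_cancel₀ _ (by linarith)

theorem stemProfile_end (hε : ε < 1 / 2) : stemProfile (freq ε) (1 / 2 - ε)
    = Real.sin starAngle * Real.cos starAngle := by
  rw [stemProfile, freq_mul hε, mul_comm]

theorem leafProfile_end (hε : ε < 1 / 2) : leafProfile (freq ε) (1 / 2 - ε)
    = Real.sin starAngle := by
  rw [leafProfile, freq_mul hε, sub_self, Real.cos_zero, mul_one]

/-- The first Dirichlet eigenfunction on the upper star, and its negative on the lower star. -/
noncomputable def starSquareFun (ε : ℝ) (hε : ε < 1 / 2) : (starSquare ε hε).Point → ℝ :=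
  (starSquare ε hε).ofEdges
    (fun
      | .v0 => 0
      | .cu => Real.sin starAngle * Real.cos starAngle
      | .cd => -(Real.sin starAngle * Real.cos starAngle)
      | .u1 | .u2 => Real.sin starAngle
      | .d1 | .d2 => -Real.sin starAngle)
    (fun
      | .su => stemProfile (freq ε)
      | .sd => -stemProfile (freq ε)
      | .u1 | .u2 => leafProfile (freq ε)
      | .d1 | .d2 => -leafProfile (freq ε))

theorem starSquareFun_mem (hε : ε < 1 / 2) :
    starSquareFun ε hε ∈ (starSquare ε hε).eigenspace (freq ε ^ 2) := by
  have hs := hasDerivAt_stemProfile (freq ε)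
  have hs' := hasDerivAt_stemProfile_deriv (freq ε)
  have hl := hasDerivAt_leafProfile (freq ε)
  have hl' := hasDerivAt_leafProfile_deriv (freq ε)
  have hkey : freq ε * (Real.cos starAngle * Real.cos starAngle)
      = freq ε * (Real.sin starAngle * Real.sin starAngle)
        + freq ε * (Real.sin starAngle * Real.sin starAngle) := by
    linear_combination freq ε * cos_sq_starAngle
  refine ofEdges_mem_eigenspace (ψ := fun
      | .su => fun t => freq ε * (Real.cos starAngle * Real.cos (freq ε * t))
      | .sd => -fun t => freq ε * (Real.cos starAngle * Real.cos (freq ε * t))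
      | .u1 | .u2 => fun t => freq ε * (Real.sin starAngle * Real.sin (starAngle - freq ε * t))
      | .d1 | .d2 => -fun t => freq ε * (Real.sin starAngle * Real.sin (starAngle - freq ε * t)))
    (fun e => ?_) (fun e => ?_) (fun e t => ?_) (fun e t => ?_)
    ((starSquare_kirchhoff_iff _ _).mpr ?_)
  · cases e <;> simp [starSquare, stemProfile, leafProfile]
  · cases e <;> simp [starSquare, stemProfile_end hε, leafProfile_end hε,
      -one_div]
  · cases e
    exacts [hs t, (hs t).neg, hl t, hl t, (hl t).neg, (hl t).neg]
  · cases e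
    · exact hs' t
    · exact (hs' t).neg.congr_deriv (by simp only [Pi.neg_apply]; ring)
    · exact hl' t
    · exact hl' t
    · exact (hl' t).neg.congr_deriv (by simp only [Pi.neg_apply]; ring)
    · exact (hl' t).neg.congr_deriv (by simp only [Pi.neg_apply]; ring)
  · simp only [starSquare, Pi.neg_apply, freq_mul hε, mul_zero, sub_zero, sub_self, Real.sin_zero,
      neg_zero, and_self, and_true, true_and, hkey]
    refine ⟨?_, ?_⟩ <;> ring

/-- The extension of the antisymmetric function on the two stars by zero to the path. -/
noncomputable def treeFun (ε : ℝ) (hε : ε < 1 / 2) : (tree ε hε).Point → ℝ :=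
  (tree ε hε).ofEdges
    (fun
      | .v0 | .vl | .vr => 0
      | .cu => Real.sin starAngle * Real.cos starAngle
      | .cd => -(Real.sin starAngle * Real.cos starAngle)
      | .u1 | .u2 => Real.sin starAngle
      | .d1 | .d2 => -Real.sin starAngle)
    (fun
      | .l | .r => 0
      | .su => stemProfile (freq ε)
      | .sd => -stemProfile (freq ε)
      | .u1 | .u2 => leafProfile (freq ε)
      | .d1 | .d2 => -leafProfile (freq ε))

theorem treeFun_edgePt (hε : ε < 1 / 2) (e : TreeEdge) {t : ℝ}
    (ht : t ∈ Icc 0 ((tree ε hε).len e)) :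
    treeFun ε hε ((tree ε hε).edgePt e t) = match e with
      | .l | .r => 0
      | .su => stemProfile (freq ε) t
      | .sd => -stemProfile (freq ε) t
      | .u1 | .u2 => leafProfile (freq ε) t
      | .d1 | .d2 => -leafProfile (freq ε) t := by
  refine (ofEdges_edgePt (fun e => ?_) (fun e => ?_) e ht).trans ?_
  · cases e <;> simp [tree, stemProfile, leafProfile]
  · cases e <;> simp [tree, stemProfile_end hε, leafProfile_end hε, -one_div]
  · cases e <;> rfl

theorem treeFun_mem (hε : ε < 1 / 2) :
    treeFun ε hε ∈ (tree ε hε).eigenspace (freq ε ^ 2) := by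
  have hs := hasDerivAt_stemProfile (freq ε)
  have hs' := hasDerivAt_stemProfile_deriv (freq ε)
  have hl := hasDerivAt_leafProfile (freq ε)
  have hl' := hasDerivAt_leafProfile_deriv (freq ε)
  have hkey : freq ε * (Real.cos starAngle * Real.cos starAngle)
      = freq ε * (Real.sin starAngle * Real.sin starAngle)
        + freq ε * (Real.sin starAngle * Real.sin starAngle) := by
    linear_combination freq ε * cos_sq_starAngle
  refine ofEdges_mem_eigenspace (ψ := fun
      | .l | .r => 0
      | .su => fun t => freq ε * (Real.cos starAngle * Real.cos (freq ε * t))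
      | .sd => -fun t => freq ε * (Real.cos starAngle * Real.cos (freq ε * t))
      | .u1 | .u2 => fun t => freq ε * (Real.sin starAngle * Real.sin (starAngle - freq ε * t))
      | .d1 | .d2 => -fun t => freq ε * (Real.sin starAngle * Real.sin (starAngle - freq ε * t)))
    (fun e => ?_) (fun e => ?_) (fun e t => ?_) (fun e t => ?_)
    ((tree_kirchhoff_iff _ _).mpr ?_)
  · cases e <;> simp [tree, stemProfile, leafProfile]
  · cases e <;> simp [tree, stemProfile_end hε, leafProfile_end hε, -one_div]
  · cases e
    exacts [hasDerivAt_const t 0, hasDerivAt_const t 0, hs t, (hs t).neg, hl t, hl t,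
      (hl t).neg, (hl t).neg]
  · cases e
    · exact (hasDerivAt_const t 0).congr_deriv (by simp)
    · exact (hasDerivAt_const t 0).congr_deriv (by simp)
    · exact hs' t
    · exact (hs' t).neg.congr_deriv (by simp only [Pi.neg_apply]; ring)
    · exact hl' t
    · exact hl' t
    · exact (hl' t).neg.congr_deriv (by simp only [Pi.neg_apply]; ring)
    · exact (hl' t).neg.congr_deriv (by simp only [Pi.neg_apply]; ring)
  · simp only [tree, Pi.neg_apply, Pi.zero_apply, freq_mul hε, mul_zero, sub_zero, sub_self,
      Real.sin_zero, neg_zero, and_self, and_true, true_and, hkey]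
    refine ⟨?_, ?_⟩ <;> ring

theorem treeFun_ne_zero (hε : ε < 1 / 2) : treeFun ε hε ≠ 0 := fun h =>
  (sin_pos_of_le starAngle_pos le_rfl).ne' (congrFun h (.vertex .u1))

theorem starSquareFun_ne_zero (hε : ε < 1 / 2) : starSquareFun ε hε ≠ 0 := fun h =>
  (sin_pos_of_le starAngle_pos le_rfl).ne' (congrFun h (.vertex .u1))

/-- The star relation forces an eigenfunction for `(θ / a)²` to vanish at `v0`; as `cos (θ / a)` is
not zero it then vanishes on the path, and it is determined by its slope on the upper stem. -/
theorem tree_eigenspace_freq (hε : ε < 1 / 2) (hk2 : freq ε < Real.pi / 2) :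
    (tree ε hε).eigenspace (freq ε ^ 2) = Submodule.span ℝ {treeFun ε hε} := by
  refine le_antisymm (fun f hf => ?_)
    ((Submodule.span_singleton_le_iff_mem _ _).mpr (treeFun_mem hε))
  have hk := freq_pos hε
  have hsin := sin_pos_of_le starAngle_pos le_rfl
  have hcos := cos_pos_of_le starAngle_pos.le le_rfl
  have hck : 0 < Real.cos (freq ε) := Real.cos_pos_of_mem_Ioo ⟨by linarith, hk2⟩
  obtain ⟨⟨hu, hd⟩, h0, -⟩ := tree_isStar hf
  obtain ⟨hl, -⟩ := tree_pendant hk.ne' hf (.inl rfl)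
  obtain ⟨hr, -⟩ := tree_pendant hk.ne' hf (.inr rfl)
  have hx : f (.vertex .v0) = 0 := by
    have h1 := hu.relation hk.ne' hf
    rw [freq_mul hε, three_mul_sin_sq_starAngle, sub_self, mul_zero] at h1
    exact (mul_eq_zero.mp h1.symm).resolve_left (by positivity)
  rw [hx, zero_mul] at hl hr
  have hl0 := (mul_eq_zero.mp hl).resolve_left hck.ne'
  have hr0 := (mul_eq_zero.mp hr).resolve_left hck.ne'
  set q := (tree ε hε).edgeDeriv f .su 0 / freq ε with hq
  have hqd : (tree ε hε).edgeDeriv f .sd 0 / freq ε = -q := by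
    have hsum : (tree ε hε).edgeDeriv f .l 0 / freq ε + (tree ε hε).edgeDeriv f .r 0 / freq ε
        + (tree ε hε).edgeDeriv f .su 0 / freq ε + (tree ε hε).edgeDeriv f .sd 0 / freq ε = 0 := by
      rw [← add_div, ← add_div, ← add_div, h0, zero_div]
    linarith
  have hpath : ∀ e : TreeEdge, (e = .l ∨ e = .r) → ∀ t ∈ Icc (0 : ℝ) 1,
      f ((tree ε hε).edgePt e t) = 0 := by
    intro e he t ht
    have := (tree_pendant hk.ne' hf he).2 t ht
    rw [hx, zero_mul] at this
    exact (mul_eq_zero.mp this).resolve_left hck.ne'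
  have hstem : ∀ e : TreeEdge, (tree ε hε).src e = .v0 → ∀ t ∈ Icc 0 ((tree ε hε).len e),
      f ((tree ε hε).edgePt e t)
        = (tree ε hε).edgeDeriv f e 0 / freq ε * Real.sin (freq ε * t) := by
    intro e he t ht
    rw [(edge_formula hk.ne' hf e ht).1, he, hx, zero_mul, zero_add]
  have hleaf : ∀ {e e₁ e₂ : TreeEdge}, (tree ε hε).IsStar f (1 / 2 - ε) e e₁ e₂ →
      (tree ε hε).src e = .v0 → ∀ t ∈ Icc 0 (1 / 2 - ε),
      f ((tree ε hε).edgePt e₁ t) = (tree ε hε).edgeDeriv f e 0 / freq ε / Real.cos starAngle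
        * leafProfile (freq ε) t := by
    intro e e₁ e₂ hs he t ht
    have := hs.leaf_formula hk.ne' hf ht
    rw [he, hx, zero_mul, zero_add, freq_mul hε] at this
    rw [leafProfile]
    rw [div_mul_eq_mul_div, eq_div_iff hcos.ne']
    linear_combination this
  refine Submodule.mem_span_singleton.mpr ⟨q / Real.cos starAngle,
    funext <| (tree ε hε).forall_point fun e t ht => ?_⟩
  rw [Pi.smul_apply, treeFun_edgePt hε e ht, smul_eq_mul]
  cases e
  · rw [hpath .l (.inl rfl) t ht, mul_zero]
  · rw [hpath .r (.inr rfl) t ht, mul_zero]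
  · rw [hstem .su rfl t ht, ← hq, stemProfile]
    field_simp
  · rw [hstem .sd rfl t ht, hqd, stemProfile]
    field_simp
  · rw [hleaf hu rfl t ht]
  · rw [hleaf hu.swap rfl t ht]
  · rw [hleaf hd rfl t ht, hqd]; ring
  · rw [hleaf hd.swap rfl t ht, hqd]; ring

/-! ### Extrema -/

theorem stemProfile_mem (hε : ε < 1 / 2) {t : ℝ} (ht : t ∈ Icc 0 (1 / 2 - ε)) :
    0 ≤ stemProfile (freq ε) t ∧ stemProfile (freq ε) t < Real.sin starAngle := by
  have hk := freq_pos hε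
  have h0 : 0 ≤ freq ε * t := mul_nonneg hk.le ht.1
  have h1 : freq ε * t ≤ starAngle := by
    rw [← freq_mul hε]; exact mul_le_mul_of_nonneg_left ht.2 hk.le
  have hsin := sin_pos_of_le starAngle_pos le_rfl
  have hcos := cos_pos_of_le starAngle_pos.le le_rfl
  have hlt : Real.cos starAngle < 1 := by
    nlinarith [Real.sin_sq_add_cos_sq starAngle]
  have h2 : 0 ≤ Real.sin (freq ε * t) := Real.sin_nonneg_of_nonneg_of_le_pi h0
    (by linarith [starAngle_lt, Real.pi_pos])
  have h3 : Real.sin (freq ε * t) ≤ Real.sin starAngle :=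
    Real.sin_le_sin_of_le_of_le_pi_div_two (by linarith [Real.pi_pos])
      (Real.arcsin_le_pi_div_two _) h1
  refine ⟨mul_nonneg hcos.le h2, ?_⟩
  rw [stemProfile]
  nlinarith

theorem leafProfile_mem (hε : ε < 1 / 2) {t : ℝ} (ht : t ∈ Icc 0 (1 / 2 - ε)) :
    0 ≤ leafProfile (freq ε) t ∧ leafProfile (freq ε) t ≤ Real.sin starAngle ∧
      (leafProfile (freq ε) t = Real.sin starAngle → t = 1 / 2 - ε) := by
  have hk := freq_pos hε
  have h0 : 0 ≤ freq ε * t := mul_nonneg hk.le ht.1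
  have h1 : freq ε * t ≤ starAngle := by
    rw [← freq_mul hε]; exact mul_le_mul_of_nonneg_left ht.2 hk.le
  have hsin := sin_pos_of_le starAngle_pos le_rfl
  have hcos := cos_pos_of_le (τ := starAngle - freq ε * t) (by linarith) (by linarith)
  refine ⟨mul_nonneg hsin.le hcos.le, mul_le_of_le_one_right hsin.le (Real.cos_le_one _),
    fun h => ?_⟩
  have h2 : Real.cos (starAngle - freq ε * t) = 1 :=
    mul_left_cancel₀ hsin.ne' (by rw [mul_one]; exact h)
  have h3 := (Real.cos_eq_one_iff_of_lt_of_lt (by linarith [Real.pi_pos])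
    (by linarith [starAngle_lt, Real.pi_pos])).mp h2
  rw [← freq_mul hε, ← mul_sub] at h3
  linarith [(mul_eq_zero.mp h3).resolve_left hk.ne']

theorem treeFun_bounds (hε : ε < 1 / 2) (p : (tree ε hε).Point) :
    (treeFun ε hε p ≤ Real.sin starAngle ∧
      (treeFun ε hε p = Real.sin starAngle → p = .vertex .u1 ∨ p = .vertex .u2)) ∧
    (-Real.sin starAngle ≤ treeFun ε hε p ∧
      (treeFun ε hε p = -Real.sin starAngle → p = .vertex .d1 ∨ p = .vertex .d2)) := by
  have hsin := sin_pos_of_le starAngle_pos le_rfl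
  revert p
  refine (tree ε hε).forall_point fun e t ht => ?_
  rw [treeFun_edgePt hε e ht]
  have hend : ∀ e : TreeEdge, t = (tree ε hε).len e →
      (tree ε hε).edgePt e t = .vertex ((tree ε hε).tgt e) := by
    rintro e rfl
    exact edgePt_len _ e
  cases e
  case l | r =>
    exact ⟨⟨hsin.le, fun h => absurd h hsin.ne⟩,
      ⟨neg_nonpos.mpr hsin.le, fun h => absurd (neg_eq_zero.mp h.symm) hsin.ne'⟩⟩
  case su =>
    obtain ⟨h1, h2⟩ := stemProfile_mem hε ht
    exact ⟨⟨h2.le, fun h => absurd h h2.ne⟩, ⟨by linarith, fun h => by linarith⟩⟩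
  case sd =>
    obtain ⟨h1, h2⟩ := stemProfile_mem hε ht
    exact ⟨⟨by linarith, fun h => by linarith⟩, ⟨by linarith, fun h => by linarith⟩⟩
  case u1 =>
    obtain ⟨h1, h2, h3⟩ := leafProfile_mem hε ht
    exact ⟨⟨h2, fun h => .inl (hend .u1 (h3 h))⟩, ⟨by linarith, fun h => by linarith⟩⟩
  case u2 =>
    obtain ⟨h1, h2, h3⟩ := leafProfile_mem hε ht
    exact ⟨⟨h2, fun h => .inr (hend .u2 (h3 h))⟩, ⟨by linarith, fun h => by linarith⟩⟩
  case d1 =>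
    obtain ⟨h1, h2, h3⟩ := leafProfile_mem hε ht
    exact ⟨⟨by linarith, fun h => by linarith⟩,
      ⟨by linarith, fun h => .inl (hend .d1 (h3 (neg_injective h)))⟩⟩
  case d2 =>
    obtain ⟨h1, h2, h3⟩ := leafProfile_mem hε ht
    exact ⟨⟨by linarith, fun h => by linarith⟩,
      ⟨by linarith, fun h => .inr (hend .d2 (h3 (neg_injective h)))⟩⟩

theorem argmax_treeFun (hε : ε < 1 / 2) :
    argmax (treeFun ε hε) = {.vertex .u1, .vertex .u2} := by
  ext p
  constructor
  · intro hp
    exact (treeFun_bounds hε p).1.2 (le_antisymm (treeFun_bounds hε p).1.1 (hp (.vertex .u1)))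
  · rintro (rfl | rfl) <;> exact fun q => (treeFun_bounds hε q).1.1

theorem argmin_treeFun (hε : ε < 1 / 2) :
    argmin (treeFun ε hε) = {.vertex .d1, .vertex .d2} := by
  ext p
  constructor
  · intro hp
    exact (treeFun_bounds hε p).2.2 (le_antisymm (hp (.vertex .d1)) (treeFun_bounds hε p).2.1)
  · rintro (rfl | rfl) <;> exact fun q => (treeFun_bounds hε q).2.1

theorem argmax_smul_of_pos {X : Type} {c : ℝ} (hc : 0 < c) (f : X → ℝ) :
    argmax (c • f) = argmax f ∧ argmin (c • f) = argmin f := by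
  constructor <;> ext p <;> exact forall_congr' fun q => mul_le_mul_iff_right₀ hc

theorem argmax_smul_of_neg {X : Type} {c : ℝ} (hc : c < 0) (f : X → ℝ) :
    argmax (c • f) = argmin f ∧ argmin (c • f) = argmax f := by
  constructor <;> ext p <;> exact forall_congr' fun q => mul_le_mul_left_of_neg hc

/-! ### The second eigenvalue -/

theorem sqrt_lt_freq {ν : ℝ} (hε : ε < 1 / 2) (h : ν < freq ε ^ 2) :
    √ν < freq ε ∧ √ν * (1 / 2 - ε) < starAngle := by
  have h1 : √ν < freq ε := (Real.sqrt_lt' (freq_pos hε)).mpr h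
  refine ⟨h1, ?_⟩
  rw [← freq_mul hε]
  exact mul_lt_mul_of_pos_right h1 (by linarith)

theorem starSquare_eigenvalue_two (hε : ε < 1 / 2) :
    (starSquare ε hε).eigenvalue 2 = freq ε ^ 2 := by
  refine eigenvalue_two (starSquare_connected ε hε) (pow_pos (freq_pos hε) 2)
    ((Submodule.ne_bot_iff _).mpr ⟨_, starSquareFun_mem hε, starSquareFun_ne_zero hε⟩)
    fun ν h0 h1 => ?_
  rw [← Real.sq_sqrt h0.le]
  exact starSquare_eigenspace_eq_bot (Real.sqrt_pos.mpr h0) (sqrt_lt_freq hε h1).2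

theorem tree_eigenspace_ne_bot (hε : ε < 1 / 2) : (tree ε hε).eigenspace (freq ε ^ 2) ≠ ⊥ :=
  (Submodule.ne_bot_iff _).mpr ⟨_, treeFun_mem hε, treeFun_ne_zero hε⟩

theorem tree_eigenspace_eq_bot_of_lt (hε : ε < 1 / 2) (hk2 : freq ε < Real.pi / 2) {ν : ℝ}
    (h0 : 0 < ν) (h1 : ν < freq ε ^ 2) : (tree ε hε).eigenspace ν = ⊥ := by
  obtain ⟨h2, h3⟩ := sqrt_lt_freq hε h1
  rw [← Real.sq_sqrt h0.le]
  exact tree_eigenspace_eq_bot (Real.sqrt_pos.mpr h0) h3 (h2.trans hk2)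

theorem tree_eigenvalue_two (hε : ε < 1 / 2) (hk2 : freq ε < Real.pi / 2) :
    (tree ε hε).eigenvalue 2 = freq ε ^ 2 :=
  eigenvalue_two (tree_connected ε hε) (pow_pos (freq_pos hε) 2) (tree_eigenspace_ne_bot hε)
    fun _ h0 h1 => tree_eigenspace_eq_bot_of_lt hε hk2 h0 h1

end Spectrum

end HotSpots

theorem mainTheorem2 :
    (∀ (ε : ℝ) (hε : ε < 1 / 2), 0 < ε →
      (HotSpots.tree ε hε).IsTree ∧
      Metric.ediam (Set.univ : Set (HotSpots.tree ε hε).Point) = 2 ∧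
      ∀ p q : (HotSpots.tree ε hε).Point,
        edist p q = Metric.ediam (Set.univ : Set (HotSpots.tree ε hε).Point) ↔
          (p = .vertex .vl ∧ q = .vertex .vr) ∨ (p = .vertex .vr ∧ q = .vertex .vl)) ∧
    ∃ ε₀ : ℝ, 0 < ε₀ ∧ ∀ ε : ℝ, 0 < ε → ε < ε₀ → ∃ hε : ε < 1 / 2,
      IsLeast {μ : ℝ | 0 < μ ∧ (HotSpots.tree ε hε).eigenspace μ ≠ ⊥}
        ((HotSpots.tree ε hε).eigenvalue 2) ∧
      (HotSpots.tree ε hε).eigenvalue 2 = (HotSpots.starSquare ε hε).eigenvalue 2 ∧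
      Module.finrank ℝ ((HotSpots.tree ε hε).eigenspace ((HotSpots.tree ε hε).eigenvalue 2)) = 1 ∧
      ∀ f ∈ (HotSpots.tree ε hε).eigenspace ((HotSpots.tree ε hε).eigenvalue 2), f ≠ 0 →
        (∀ p ∈ HotSpots.pathPart ε hε, f p = 0) ∧
        ((HotSpots.argmax f = {.vertex .u1, .vertex .u2} ∧
            HotSpots.argmin f = {.vertex .d1, .vertex .d2}) ∨
          (HotSpots.argmax f = {.vertex .d1, .vertex .d2} ∧
            HotSpots.argmin f = {.vertex .u1, .vertex .u2})) ∧
        ∀ p ∈ HotSpots.argmax f ∪ HotSpots.argmin f,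
          ∀ q ∈ HotSpots.argmax f ∪ HotSpots.argmin f,
            edist p q < Metric.ediam (Set.univ : Set (HotSpots.tree ε hε).Point) := by
  refine ⟨fun ε hε h0 => ⟨HotSpots.tree_isTree ε hε, HotSpots.ediam_tree h0, fun p q => ?_⟩, ?_⟩
  · rw [HotSpots.ediam_tree h0]
    exact HotSpots.edist_eq_two_iff h0 p q
  have hπ := Real.pi_pos
  -- For `ε` below this bound, `θ / (1 / 2 - ε) < π / 2`, the first frequency of the intervals.
  refine ⟨1 / 2 - 2 * HotSpots.starAngle / Real.pi, ?_, fun ε h0 hlt => ?_⟩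
  · rw [sub_pos, div_lt_iff₀ hπ]
    linarith [HotSpots.starAngle_lt]
  have hθ : 0 < 2 * HotSpots.starAngle / Real.pi :=
    div_pos (mul_pos two_pos HotSpots.starAngle_pos) hπ
  have hε : ε < 1 / 2 := by linarith
  have hk2 : HotSpots.freq ε < Real.pi / 2 := by
    rw [HotSpots.freq, div_lt_iff₀ (by linarith)]
    have h1 : 2 * HotSpots.starAngle / Real.pi < 1 / 2 - ε := by linarith
    rw [div_lt_iff₀ hπ] at h1
    linarith
  refine ⟨hε, ?_⟩
  rw [HotSpots.tree_eigenvalue_two hε hk2, HotSpots.starSquare_eigenvalue_two hε,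
    HotSpots.tree_eigenspace_freq hε hk2]
  refine ⟨⟨⟨pow_pos (HotSpots.freq_pos hε) 2, HotSpots.tree_eigenspace_ne_bot hε⟩, ?_⟩, rfl,
    finrank_span_singleton (HotSpots.treeFun_ne_zero hε), fun f hf hf0 => ?_⟩
  · rintro ν ⟨hν, hne⟩
    by_contra! h
    exact hne (HotSpots.tree_eigenspace_eq_bot_of_lt hε hk2 hν h)
  obtain ⟨c, rfl⟩ := Submodule.mem_span_singleton.mp hf
  have hc : c ≠ 0 := fun h => hf0 (by rw [h, zero_smul])
  have hext : (HotSpots.argmax (c • HotSpots.treeFun ε hε) = {.vertex .u1, .vertex .u2} ∧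
        HotSpots.argmin (c • HotSpots.treeFun ε hε) = {.vertex .d1, .vertex .d2}) ∨
      (HotSpots.argmax (c • HotSpots.treeFun ε hε) = {.vertex .d1, .vertex .d2} ∧
        HotSpots.argmin (c • HotSpots.treeFun ε hε) = {.vertex .u1, .vertex .u2}) := by
    rcases hc.lt_or_gt with hc | hc
    · right
      rw [(HotSpots.argmax_smul_of_neg hc _).1, (HotSpots.argmax_smul_of_neg hc _).2]
      exact ⟨HotSpots.argmin_treeFun hε, HotSpots.argmax_treeFun hε⟩
    · left
      rw [(HotSpots.argmax_smul_of_pos hc _).1, (HotSpots.argmax_smul_of_pos hc _).2]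
      exact ⟨HotSpots.argmax_treeFun hε, HotSpots.argmin_treeFun hε⟩
  refine ⟨?_, hext, ?_⟩
  · rintro p (⟨t, ht, rfl⟩ | ⟨t, ht, rfl⟩)
    · rw [Pi.smul_apply, HotSpots.treeFun_edgePt hε .l ht, smul_zero]
    · rw [Pi.smul_apply, HotSpots.treeFun_edgePt hε .r ht, smul_zero]
  · intro p hp q _
    rw [HotSpots.ediam_tree h0]
    refine lt_of_le_of_ne (HotSpots.edist_le_two h0 p q) fun h => ?_
    have hp' : p = .vertex .vl ∨ p = .vertex .vr :=
      ((HotSpots.edist_eq_two_iff h0 p q).mp h).imp And.left And.left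
    rcases hext with ⟨h1, h2⟩ | ⟨h1, h2⟩ <;> rw [h1, h2] at hp <;>
      rcases hp' with rfl | rfl <;> simp at hp
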